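/- Let $n\ge 0$ and $m,r\ge 1$ be integers, $1\le p<\infty$, $-\infty<a<b<\infty$ and $\varepsilon_0>0$. Let $W^k_p$ denote the complex Sobolev space on $[a,b]$ with norm $\|x\|_{k,p}=\bigl(\sum_{j=0}^{k}\int_a^b|x^{(j)}(t)|^p\,dt\bigr)^{1/p}$; the norm of a vector- or matrix-valued function is the sum of the norms of its components. For each $\varepsilon\in[0,\varepsilon_0)$ let $A_{0}(\cdot,\varepsilon),\dots,A_{r-1}(\cdot,\varepsilon)\in(W^n_p)^{m\times m}$, let $B(\varepsilon):(W^{n+r}_p)^m\to\mathbb{C}^{rm}$ be a continuous linear operator, and put $$L(\varepsilon)y=y^{(r)}+\sum_{j=1}^{r}A_{r-j}(\cdot,\varepsilon)\,y^{(r-j)},\qquad y\in(W^{n+r}_p)^m.$$ For $f(\cdot,\varepsilon)\in(W^n_p)^m$ and $c(\varepsilon)\in\mathbb{C}^{rm}$ consider the boundary-value problem $$L(\varepsilon)y(\cdot,\varepsilon)=f(\cdot,\varepsilon)\ \text{ on } [a,b],\qquad B(\varepsilon)y(\cdot,\varepsilon)=c(\varepsilon),\qquad y(\cdot,\varepsilon)\in(W^{n+r}_p)^m,\tag{P}$$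 where the differential equation holds at every point of $[a,b]$ if $n\ge1$ and almost everywhere if $n=0$. Assume: (0) the problem $L(0)y=0$, $B(0)y=0$ has only the trivial solution; (I) $\|A_{r-j}(\cdot,\varepsilon)-A_{r-j}(\cdot,0)\|_{n,p}\to0$ as $\varepsilon\to0+$ for each $j\in\{1,\dots,r\}$; (II) $B(\varepsilon)y\to B(0)y$ in $\mathbb{C}^{rm}$ as $\varepsilon\to0+$ for every $y\in(W^{n+r}_p)^m$. Then there is $\varepsilon_1\in(0,\varepsilon_0)$ such that for every $\varepsilon\in[0,\varepsilon_1)$ and all $f(\cdot,\varepsilon)\in(W^n_p)^m$, $c(\varepsilon)\in\mathbb{C}^{rm}$ the problem (P) has a unique solution $y(\cdot,\varepsilon)$, and there are positive numbers $\varepsilon_2<\varepsilon_1$, $\gamma_1$ and $\gamma_2$, independent of the right-hand sides $f,c$ and of the solutions, such that for every $\varepsilon\in(0,\varepsilon_2)$ $$\gamma_1\,d(\varepsilon)\le\|y(\cdot,0)-y(\cdot,\varepsilon)\|_{n+r,p}\le\gamma_2\,d(\varepsilon),$$ where $$d(\varepsilon)=\|L(\varepsilon)y(\cdot,0)-f(\cdot,\varepsilon)\|_{n,p}+\|B(\varepsilon)y(\cdot,0)-c(\varepsilon)\|_{\mathbb{C}^{rm}}.$$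 -/

import Mathlib

open MeasureTheory Set Filter Topology

noncomputable section

namespace BVP

/-- `x` belongs to the complex Sobolev space `W^k_p([a,b])`, `1 ≤ p < ∞`:
for `k = 0` this is `L_p`; for `k ≥ 1`, `x` is `C^{k-1}` on `[a,b]`, its derivative `x^(k-1)` is
absolutely continuous on `[a,b]`, and the almost everywhere defined derivative `x^(k)` is in `L_p`.
All derivatives are taken within `[a,b]`; the values of `x` outside `[a,b]` play no role. -/
def MemSobolev (p a b : ℝ) : ℕ → (ℝ → ℂ) → Prop
  | 0, x => MemLp x (ENNReal.ofReal p) (volume.restrict (Icc a b))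
  | k + 1, x =>
      ContDiffOn ℝ k x (Icc a b) ∧
      AbsolutelyContinuousOnInterval (iteratedDerivWithin k x (Icc a b)) a b ∧
      MemLp (iteratedDerivWithin (k + 1) x (Icc a b)) (ENNReal.ofReal p)
        (volume.restrict (Icc a b))

/-- The norm `(∑_{j ≤ k} ∫_a^b |x^(j)(t)|^p dt)^(1/p)` of the scalar space `W^k_p([a,b])`. -/
def sobolevNorm (p a b : ℝ) (k : ℕ) (x : ℝ → ℂ) : ℝ :=
  (∑ j ∈ Finset.range (k + 1),
    ∫ t in a..b, ‖iteratedDerivWithin j x (Icc a b) t‖ ^ p) ^ (1 / p)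

/-- The norm of a vector-valued function: the sum of the norms of its components. -/
def vecNorm (p a b : ℝ) (k : ℕ) {m : ℕ} (x : ℝ → Fin m → ℂ) : ℝ :=
  ∑ i, sobolevNorm p a b k (fun t => x t i)

/-- A matrix-valued function belongs to `W^k_p` if all its entries do. -/
def MemSobolevMat (p a b : ℝ) (k : ℕ) {m : ℕ} (M : ℝ → Matrix (Fin m) (Fin m) ℂ) : Prop :=
  ∀ i j, MemSobolev p a b k (fun t => M t i j)

/-- The norm of a matrix-valued function: the sum of the norms of its entries. -/
def matNorm (p a b : ℝ) (k : ℕ) {m : ℕ} (M : ℝ → Matrix (Fin m) (Fin m) ℂ) : ℝ :=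
  ∑ i, ∑ j, sobolevNorm p a b k (fun t => M t i j)

theorem iteratedDerivWithin_add_ae {p a b : ℝ} (hab : a < b) {k : ℕ} {x y : ℝ → ℂ}
    (hx : MemSobolev p a b (k + 1) x) (hy : MemSobolev p a b (k + 1) y) :
    iteratedDerivWithin (k + 1) (x + y) (Icc a b) =ᵐ[volume.restrict (Icc a b)]
      iteratedDerivWithin (k + 1) x (Icc a b) + iteratedDerivWithin (k + 1) y (Icc a b) := by
  have hu := uniqueDiffOn_Icc hab
  have h1 := hx.2.1.boundedVariationOn.ae_differentiableAt_of_mem_uIcc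
  have h2 := hy.2.1.boundedVariationOn.ae_differentiableAt_of_mem_uIcc
  rw [EventuallyEq, ae_restrict_iff' measurableSet_Icc]
  filter_upwards [h1, h2] with t ht1 ht2 ht
  rw [uIcc_of_le hab.le] at ht1 ht2
  have he : EqOn (iteratedDerivWithin k (x + y) (Icc a b))
      (iteratedDerivWithin k x (Icc a b) + iteratedDerivWithin k y (Icc a b)) (Icc a b) :=
    fun s hs => iteratedDerivWithin_add hs hu (hx.1 s hs) (hy.1 s hs)
  simp only [Pi.add_apply, iteratedDerivWithin_succ]
  rw [derivWithin_congr he (he ht),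
    derivWithin_add (ht1 ht).differentiableWithinAt (ht2 ht).differentiableWithinAt]

theorem absolutelyContinuous_congr {a b : ℝ} (hab : a < b) {u v : ℝ → ℂ}
    (h : EqOn u v (Icc a b)) (hv : AbsolutelyContinuousOnInterval v a b) :
    AbsolutelyContinuousOnInterval u a b := by
  refine Tendsto.congr' ?_ hv
  refine Filter.mem_inf_of_right (mem_principal.2 fun E hE => ?_)
  refine Finset.sum_congr rfl fun i hi => ?_
  have := hE.1 i hi
  rw [uIcc_of_le hab.le] at this
  rw [h this.1, h this.2]

theorem MemSobolev.add {p a b : ℝ} (hab : a < b) {k : ℕ} {x y : ℝ → ℂ}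
    (hx : MemSobolev p a b k x) (hy : MemSobolev p a b k y) : MemSobolev p a b k (x + y) := by
  cases k with
  | zero => exact MemLp.add hx hy
  | succ k =>
    refine ⟨hx.1.add hy.1, absolutelyContinuous_congr hab (fun s hs => ?_) (hx.2.1.add hy.2.1),
      (memLp_congr_ae (iteratedDerivWithin_add_ae hab hx hy)).2 (hx.2.2.add hy.2.2)⟩
    exact iteratedDerivWithin_add hs (uniqueDiffOn_Icc hab) (hx.1 s hs) (hy.1 s hs)

theorem MemSobolev.const_smul {p a b : ℝ} {k : ℕ} {x : ℝ → ℂ} (c : ℂ)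
    (hx : MemSobolev p a b k x) : MemSobolev p a b k (c • x) := by
  have e : ∀ j, iteratedDerivWithin j (c • x) (Icc a b)
      = c • iteratedDerivWithin j x (Icc a b) := fun j =>
    funext fun t => iteratedDerivWithin_const_smul_field c x
  cases k with
  | zero => exact MemLp.const_smul hx c
  | succ k =>
    refine ⟨contDiffOn_const.smul hx.1, ?_, ?_⟩
    · rw [e]; exact hx.2.1.const_smul c
    · rw [e]; exact hx.2.2.const_smul c

theorem MemSobolev.zero (p a b : ℝ) (k : ℕ) : MemSobolev p a b k (0 : ℝ → ℂ) := by
  have e : ∀ j, iteratedDerivWithin j (0 : ℝ → ℂ) (Icc a b) = 0 := fun j => by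
    have := funext fun t =>
      iteratedDerivWithin_const_smul_field (n := j) (s := Icc a b) (x := t) (0 : ℂ) (0 : ℝ → ℂ)
    rw [zero_smul] at this
    rw [this]
    funext t
    simp
  cases k with
  | zero => exact MemLp.zero'
  | succ k =>
    refine ⟨contDiffOn_const, ?_, ?_⟩
    · rw [e]
      exact (LipschitzOnWith.of_dist_le_mul (K := 0)
        (fun _ _ _ _ => by simp)).absolutelyContinuousOnInterval
    · rw [e]; exact MemLp.zero'

/-- The complex vector space `(W^k_p)^m` of functions `[a,b] → ℂ^m` with components in `W^k_p`,
seminormed by `vecNorm p a b k`. Its elements are functions on `ℝ` of which only the restriction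
to `[a,b]` matters (only up to equality almost everywhere if `k = 0`). -/
def SobolevVec {a b : ℝ} (hab : a < b) (p : ℝ) (k m : ℕ) : Submodule ℂ (ℝ → Fin m → ℂ) where
  carrier := {x | ∀ i, MemSobolev p a b k (fun t => x t i)}
  add_mem' hx hy i := (hx i).add hab (hy i)
  zero_mem' _ := MemSobolev.zero p a b k
  smul_mem' c _ hx i := (hx i).const_smul c

/-- The `k`-th derivative within `[a,b]` of a vector-valued function, taken componentwise. -/
def vecDeriv (a b : ℝ) (k : ℕ) {m : ℕ} (y : ℝ → Fin m → ℂ) (t : ℝ) : Fin m → ℂ :=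
  fun i => iteratedDerivWithin k (fun s => y s i) (Icc a b) t

/-- The differential expression `L y = y^(r) + ∑_{k < r} A_k y^(k)`. -/
def diffExpr (a b : ℝ) {m r : ℕ} (A : Fin r → ℝ → Matrix (Fin m) (Fin m) ℂ)
    (y : ℝ → Fin m → ℂ) (t : ℝ) : Fin m → ℂ :=
  vecDeriv a b r y t + ∑ k : Fin r, (A k t).mulVec (vecDeriv a b k y t)

/-- Equality of two vector-valued functions of class `W^n_p` on `[a,b]`:
at every point if `n ≥ 1`, almost everywhere if `n = 0`. -/
def EqSobolev (a b : ℝ) (n : ℕ) {m : ℕ} (u v : ℝ → Fin m → ℂ) : Prop :=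
  if n = 0 then ∀ᵐ t ∂(volume.restrict (Icc a b)), u t = v t else ∀ t ∈ Icc a b, u t = v t

/-- The linear operator `B : (W^k_p)^m → ℂ^N` is continuous, that is, bounded. -/
def IsBoundedOp {a b : ℝ} {hab : a < b} {p : ℝ} {k m N : ℕ}
    (B : SobolevVec hab p k m →ₗ[ℂ] EuclideanSpace ℂ (Fin N)) : Prop :=
  ∃ C : ℝ, ∀ y : SobolevVec hab p k m, ‖B y‖ ≤ C * vecNorm p a b k (y : ℝ → Fin m → ℂ)

/-- `y ∈ (W^{n+r}_p)^m` solves the boundary-value problem `L y = f` on `[a,b]`, `B y = c`. -/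
def IsSolution {a b : ℝ} {hab : a < b} {p : ℝ} {n m r : ℕ}
    (A : Fin r → ℝ → Matrix (Fin m) (Fin m) ℂ)
    (B : SobolevVec hab p (n + r) m →ₗ[ℂ] EuclideanSpace ℂ (Fin (r * m)))
    (f : ℝ → Fin m → ℂ) (c : EuclideanSpace ℂ (Fin (r * m)))
    (y : SobolevVec hab p (n + r) m) : Prop :=
  EqSobolev a b n (diffExpr a b A y) f ∧ B y = c

/-- The discrepancy `‖L y - f‖_{n,p} + ‖B y - c‖`. -/
def discrepancy {a b : ℝ} {hab : a < b} {p : ℝ} {n m r : ℕ}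
    (A : Fin r → ℝ → Matrix (Fin m) (Fin m) ℂ)
    (B : SobolevVec hab p (n + r) m →ₗ[ℂ] EuclideanSpace ℂ (Fin (r * m)))
    (f : ℝ → Fin m → ℂ) (c : EuclideanSpace ℂ (Fin (r * m)))
    (y : SobolevVec hab p (n + r) m) : ℝ :=
  vecNorm p a b n (fun t => diffExpr a b A y t - f t) + ‖B y - c‖

/-- Condition (0): the homogeneous limiting problem has only the trivial solution. -/
def ConditionZero {a b : ℝ} {hab : a < b} {p : ℝ} {n m r : ℕ}
    (A : ℝ → Fin r → ℝ → Matrix (Fin m) (Fin m) ℂ)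
    (B : ℝ → SobolevVec hab p (n + r) m →ₗ[ℂ] EuclideanSpace ℂ (Fin (r * m))) : Prop :=
  ∀ y : SobolevVec hab p (n + r) m, IsSolution (A 0) (B 0) 0 0 y →
    ∀ t ∈ Icc a b, (y : ℝ → Fin m → ℂ) t = 0

/-- Limit Condition (I): the coefficients converge in `(W^n_p)^{m×m}` as `ε → 0+`. -/
def LimitConditionI (p a b : ℝ) (n : ℕ) {m r : ℕ}
    (A : ℝ → Fin r → ℝ → Matrix (Fin m) (Fin m) ℂ) : Prop :=
  ∀ k : Fin r, Tendsto (fun ε => matNorm p a b n (fun t => A ε k t - A 0 k t)) (𝓝[>] 0) (𝓝 0)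

/-- Limit Condition (II): `B(ε) y → B(0) y` as `ε → 0+` for every `y ∈ (W^{n+r}_p)^m`. -/
def LimitConditionII {a b : ℝ} {hab : a < b} {p : ℝ} {k m N : ℕ}
    (B : ℝ → SobolevVec hab p k m →ₗ[ℂ] EuclideanSpace ℂ (Fin N)) : Prop :=
  ∀ y : SobolevVec hab p k m, Tendsto (fun ε => B ε y) (𝓝[>] 0) (𝓝 (B 0 y))

end BVP

end

/-! Problem (P) is the equation T(ε)y = (f, c) for the bounded operator T(ε) = (L(ε), B(ε)) from
(W^{n+r}_p)^m to (W^n_p)^m × ℂ^{rm}. Both claims follow once T(ε) is invertible for small ε, with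
T(ε) and its inverse bounded uniformly: T(ε) maps y(·,0) − y(·,ε) to (L(ε)y(·,0) − f(·,ε),
B(ε)y(·,0) − c(ε)), whose norm is comparable with d(ε).

T(0) is invertible because the Cauchy problem is solvable (`exists_cauchy`): L(0) together with the
Cauchy data is onto, so the kernel of L(0) has dimension at least rm. By condition (0), B(0) is
injective on that kernel, hence bijective from it onto ℂ^{rm} (`bijective_prod_of_surjective`).

For small ε, condition (I) gives L(ε) → L(0) in norm, but (II) gives only strong convergence of
B(ε), so T(ε) need not converge in norm. Write T(ε) = (1 + D(ε))T(0). The ℂ^{rm}-component of D(ε)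
is bounded by Banach–Steinhaus, and restricted to the finite-dimensional factor ℂ^{rm} it tends to
zero in norm. Therefore D(ε)² → 0 in norm even if D(ε) does not, and (1 + D)(1 − D) = 1 − D² yields
invertibility with uniform bounds (`eventually_bijective_prod`).

To work in a Banach space, a function is replaced by its image under `toData`: initial values and
the L_p class of the highest derivative. Only functions vanishing almost everywhere on [a,b] are
lost. -/

noncomputable section

namespace BVP

/-! ### Absolute continuity and the fundamental theorem of calculus -/

theorem absolutelyContinuous_primitive {a b : ℝ} {g : ℝ → ℂ}
    (hg : IntervalIntegrable g volume a b) (c : ℂ) :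
    AbsolutelyContinuousOnInterval (fun t => c + ∫ s in a..t, g s) a b := by
  -- Increments of the primitive of `g` are dominated by those of the primitive of `‖g‖`.
  have hG := hg.norm.absolutelyContinuousOnInterval_intervalIntegral (c := a) left_mem_uIcc
  refine squeeze_zero' (Eventually.of_forall fun E => Finset.sum_nonneg fun i _ => dist_nonneg)
    ?_ hG
  refine Filter.mem_inf_of_right (mem_principal.2 fun E hE => ?_)
  rw [mem_ofPred_eq]
  refine Finset.sum_le_sum fun i hi => ?_
  obtain ⟨h1, h2⟩ := hE.1 i hi
  have sub : ∀ {u v : ℝ}, u ∈ uIcc a b → v ∈ uIcc a b → IntervalIntegrable g volume u v :=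
    fun hu hv => hg.mono_set (uIcc_subset_uIcc hu hv)
  have ha : a ∈ uIcc a b := left_mem_uIcc
  rw [dist_add_left, dist_comm, dist_eq_norm, dist_comm, dist_eq_norm,
    intervalIntegral.integral_interval_sub_left (sub ha h2) (sub ha h1),
    intervalIntegral.integral_interval_sub_left (sub ha h2).norm (sub ha h1).norm]
  exact intervalIntegral.norm_integral_le_abs_integral_norm

theorem ae_hasDerivAt_of_absolutelyContinuous {a b : ℝ} (hab : a < b) {x : ℝ → ℂ}
    (hx : AbsolutelyContinuousOnInterval x a b) :
    ∀ᵐ t ∂(volume.restrict (Icc a b)), HasDerivAt x (derivWithin x (Icc a b) t) t := by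
  have h := hx.boundedVariationOn.ae_differentiableAt_of_mem_uIcc
  rw [ae_restrict_iff' measurableSet_Icc]
  filter_upwards [h] with t ht hti
  rw [uIcc_of_le hab.le] at ht
  have hd := (ht hti).hasDerivAt
  rwa [hd.hasDerivWithinAt.derivWithin (uniqueDiffOn_Icc hab t hti)]

theorem ae_hasDerivAt_primitive {a b : ℝ} (hab : a < b) {g : ℝ → ℂ}
    (hg : IntervalIntegrable g volume a b) (c : ℂ) :
    ∀ᵐ t ∂(volume.restrict (Icc a b)), HasDerivAt (fun t => c + ∫ s in a..t, g s) (g t) t := by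
  rw [ae_restrict_iff' measurableSet_Icc]
  filter_upwards [hg.ae_hasDerivAt_integral] with t ht hti
  rw [uIcc_of_le hab.le] at ht
  exact (ht hti a (left_mem_Icc.2 hab.le)).const_add c

/-- The fundamental theorem of calculus for absolutely continuous complex functions. -/
theorem eq_add_integral_of_absolutelyContinuous {a b : ℝ} (hab : a < b) {x g : ℝ → ℂ}
    (hx : AbsolutelyContinuousOnInterval x a b)
    (hg : IntervalIntegrable g volume a b)
    (hxg : derivWithin x (Icc a b) =ᵐ[volume.restrict (Icc a b)] g) :
    EqOn x (fun t => x a + ∫ s in a..t, g s) (Icc a b) := by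
  have hz : AbsolutelyContinuousOnInterval (x - fun t => x a + ∫ s in a..t, g s) a b :=
    hx.sub (absolutelyContinuous_primitive hg (x a))
  obtain ⟨C, hC⟩ := hz.const_of_ae_hasDerivAt_zero (by
    have h1 := ae_hasDerivAt_of_absolutelyContinuous hab hx
    have h2 := ae_hasDerivAt_primitive hab hg (x a)
    rw [uIcc_of_le hab.le, ← ae_restrict_iff' measurableSet_Icc]
    filter_upwards [h1, h2, hxg] with t h1 h2 h3
    have := h1.sub h2
    rwa [h3, sub_self] at this)
  rw [uIcc_of_le hab.le] at hC
  have h0 := hC a (left_mem_Icc.2 hab.le)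
  simp only [Pi.sub_apply, intervalIntegral.integral_same, add_zero, sub_self] at h0
  intro t ht
  have := hC t ht
  rw [← h0, Pi.sub_apply] at this
  exact sub_eq_zero.1 this

/-! ### Differentiation and integration in the classes W^k_p -/

theorem MemSobolev.congr {p a b : ℝ} (hab : a < b) {k : ℕ} {x y : ℝ → ℂ}
    (h : EqOn x y (Icc a b)) (hx : MemSobolev p a b k x) : MemSobolev p a b k y := by
  have e : ∀ j, EqOn (iteratedDerivWithin j x (Icc a b)) (iteratedDerivWithin j y (Icc a b))
      (Icc a b) := fun j => iteratedDerivWithin_congr h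
  have e' : ∀ j, iteratedDerivWithin j x (Icc a b) =ᵐ[volume.restrict (Icc a b)]
      iteratedDerivWithin j y (Icc a b) := fun j =>
    (ae_restrict_iff' measurableSet_Icc).2 (Eventually.of_forall fun t ht => e j ht)
  cases k with
  | zero => exact (memLp_congr_ae (by simpa using e' 0)).1 hx
  | succ k =>
    exact ⟨hx.1.congr fun t ht => (h ht).symm, absolutelyContinuous_congr hab (e k).symm hx.2.1,
      (memLp_congr_ae (e' (k + 1))).1 hx.2.2⟩

theorem MemSobolev.derivWithin {p a b : ℝ} (hab : a < b) {k : ℕ} {x : ℝ → ℂ}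
    (hx : MemSobolev p a b (k + 1) x) : MemSobolev p a b k (derivWithin x (Icc a b)) := by
  cases k with
  | zero => simpa [iteratedDerivWithin_succ', MemSobolev] using hx.2.2
  | succ k =>
    obtain ⟨h1, h2, h3⟩ := hx
    rw [iteratedDerivWithin_succ'] at h2 h3
    refine ⟨?_, h2, h3⟩
    push_cast at h1
    exact ((contDiffOn_succ_iff_derivWithin (uniqueDiffOn_Icc hab)).1 h1).2.2

theorem MemSobolev.continuousOn {p a b : ℝ} {k : ℕ} {x : ℝ → ℂ}
    (hx : MemSobolev p a b (k + 1) x) : ContinuousOn x (Icc a b) := hx.1.continuousOn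

theorem MemSobolev.absolutelyContinuous {p a b : ℝ} (hab : a < b) {k : ℕ} {x : ℝ → ℂ}
    (hx : MemSobolev p a b (k + 1) x) : AbsolutelyContinuousOnInterval x a b := by
  cases k with
  | zero => simpa using hx.2.1
  | succ k =>
    refine ContDiffOn.absolutelyContinuousOnInterval ?_
    rw [uIcc_of_le hab.le]
    exact hx.1.of_le (by norm_cast; omega)

theorem memLp_of_continuousOn {p a b : ℝ} {x : ℝ → ℂ} (hx : ContinuousOn x (Icc a b)) :
    MemLp x (ENNReal.ofReal p) (volume.restrict (Icc a b)) := by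
  obtain ⟨C, hC⟩ := isCompact_Icc.exists_bound_of_continuousOn hx
  exact MemLp.of_bound (hx.aestronglyMeasurable measurableSet_Icc) C
    ((ae_restrict_iff' measurableSet_Icc).2 (Eventually.of_forall hC))

theorem MemSobolev.memLp {p a b : ℝ} {k : ℕ} {x : ℝ → ℂ}
    (hx : MemSobolev p a b k x) : MemLp x (ENNReal.ofReal p) (volume.restrict (Icc a b)) := by
  cases k with
  | zero => exact hx
  | succ k => exact memLp_of_continuousOn hx.continuousOn

theorem intervalIntegrable_of_memLp {p a b : ℝ} (hp : 1 ≤ p) (hab : a < b) {x : ℝ → ℂ}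
    (hx : MemLp x (ENNReal.ofReal p) (volume.restrict (Icc a b))) :
    IntervalIntegrable x volume a b := by
  rw [intervalIntegrable_iff_integrableOn_Icc_of_le hab.le]
  exact hx.integrable (ENNReal.one_le_ofReal.2 hp)

theorem MemSobolev.eqOn_primitive {p a b : ℝ} (hp : 1 ≤ p) (hab : a < b) {k : ℕ} {x : ℝ → ℂ}
    (hx : MemSobolev p a b (k + 1) x) :
    EqOn x (fun t => x a + ∫ s in a..t, _root_.derivWithin x (Icc a b) s) (Icc a b) :=
  eq_add_integral_of_absolutelyContinuous hab (hx.absolutelyContinuous hab)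
    (intervalIntegrable_of_memLp hp hab (hx.derivWithin hab).memLp) EventuallyEq.rfl

theorem derivWithin_primitive_ae {a b : ℝ} (hab : a < b) {g : ℝ → ℂ}
    (hg : IntervalIntegrable g volume a b) (c : ℂ) :
    derivWithin (fun t => c + ∫ s in a..t, g s) (Icc a b) =ᵐ[volume.restrict (Icc a b)] g := by
  filter_upwards [ae_hasDerivAt_primitive hab hg c, ae_restrict_mem measurableSet_Icc] with t h ht
  exact h.hasDerivWithinAt.derivWithin (uniqueDiffOn_Icc hab t ht)

theorem hasDerivWithinAt_primitive {a b : ℝ} {g : ℝ → ℂ}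
    (hg : ContinuousOn g (Icc a b)) (c : ℂ) {t : ℝ} (ht : t ∈ Icc a b) :
    HasDerivWithinAt (fun t => c + ∫ s in a..t, g s) (g t) (Icc a b) t := by
  have hi : IntervalIntegrable g volume a t :=
    (hg.mono (by rw [uIcc_of_le ht.1]; exact Icc_subset_Icc_right ht.2)).intervalIntegrable
  have : Fact (t ∈ Icc a b) := ⟨ht⟩
  exact (intervalIntegral.integral_hasDerivWithinAt_right hi
    (hg.stronglyMeasurableAtFilter_nhdsWithin measurableSet_Icc t) (hg t ht)).const_add c

/-- For `k = 0` the primitive has derivative `g` only almost everywhere, which suffices for the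
`L_p` condition. For larger `k` the continuity of `g` makes it the derivative at every point of
`[a,b]`, and smoothness passes upwards. -/
theorem MemSobolev.primitive {p a b : ℝ} (hp : 1 ≤ p) (hab : a < b) {k : ℕ} {g : ℝ → ℂ}
    (hg : MemSobolev p a b k g) (c : ℂ) :
    MemSobolev p a b (k + 1) (fun t => c + ∫ s in a..t, g s) := by
  have hi := intervalIntegrable_of_memLp hp hab hg.memLp
  have hac := absolutelyContinuous_primitive hi c
  cases k with
  | zero =>
    refine ⟨?_, by simpa using hac, ?_⟩
    · have := hac.continuousOn
      rw [uIcc_of_le hab.le] at this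
      simpa using this
    · rw [iteratedDerivWithin_succ', iteratedDerivWithin_zero]
      exact (memLp_congr_ae (derivWithin_primitive_ae hab hi c)).2 hg
  | succ k =>
    have hd := fun t ht => hasDerivWithinAt_primitive hg.continuousOn c (t := t) ht
    have he : EqOn g (_root_.derivWithin (fun t => c + ∫ s in a..t, g s) (Icc a b)) (Icc a b) :=
      fun t ht => ((hd t ht).derivWithin (uniqueDiffOn_Icc hab t ht)).symm
    have hg' := hg.congr hab he
    refine ⟨?_, by rw [iteratedDerivWithin_succ']; exact hg'.2.1,
      by rw [iteratedDerivWithin_succ']; exact hg'.2.2⟩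
    push_cast
    exact (contDiffOn_succ_iff_derivWithin (uniqueDiffOn_Icc hab)).2
      ⟨fun t ht => (hd t ht).differentiableWithinAt, by simp, hg'.1⟩

theorem MemSobolev.of_succ {p a b : ℝ} (hab : a < b) {k : ℕ} {x : ℝ → ℂ}
    (hx : MemSobolev p a b (k + 1) x) : MemSobolev p a b k x := by
  induction k generalizing x with
  | zero => exact memLp_of_continuousOn hx.continuousOn
  | succ k ih =>
    have h := ih (hx.derivWithin hab)
    refine ⟨hx.1.of_le (by norm_cast; omega), ?_, ?_⟩
    · cases k with
      | zero => simpa using hx.absolutelyContinuous hab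
      | succ k => rw [iteratedDerivWithin_succ']; exact h.2.1
    · rw [iteratedDerivWithin_succ']
      cases k with
      | zero => simpa [MemSobolev] using h
      | succ k => exact h.2.2

theorem MemSobolev.of_le {p a b : ℝ} (hab : a < b) {k l : ℕ} (hkl : l ≤ k) {x : ℝ → ℂ}
    (hx : MemSobolev p a b k x) : MemSobolev p a b l x := by
  induction k, hkl using Nat.le_induction with
  | base => exact hx
  | succ k _ ih => exact ih (hx.of_succ hab)

theorem MemSobolev.iteratedDerivWithin {p a b : ℝ} (hab : a < b) {k j : ℕ} {x : ℝ → ℂ}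
    (hx : MemSobolev p a b (k + j) x) :
    MemSobolev p a b k (iteratedDerivWithin j x (Icc a b)) := by
  induction j generalizing x with
  | zero => simpa using hx
  | succ j ih =>
    rw [iteratedDerivWithin_succ']
    exact ih (MemSobolev.derivWithin hab (k := k + j) hx)

/-- A function of class `W^k_p` is, for `k ≥ 1`, determined on `[a,b]` by its values almost
everywhere. -/
theorem MemSobolev.eqOn_of_ae {p a b : ℝ} (hab : a < b) {k l : ℕ} {x y : ℝ → ℂ}
    (hx : MemSobolev p a b (k + 1) x) (hy : MemSobolev p a b (l + 1) y)
    (h : x =ᵐ[volume.restrict (Icc a b)] y) : EqOn x y (Icc a b) :=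
  Measure.eqOn_Icc_of_ae_eq volume hab.ne h hx.continuousOn hy.continuousOn

theorem MemSobolev.iteratedDerivWithin_ae {p a b : ℝ} (hab : a < b) {k : ℕ} {x y : ℝ → ℂ}
    (hx : MemSobolev p a b k x) (hy : MemSobolev p a b k y)
    (h : x =ᵐ[volume.restrict (Icc a b)] y) {j : ℕ} (hj : j ≤ k) :
    _root_.iteratedDerivWithin j x (Icc a b) =ᵐ[volume.restrict (Icc a b)]
      _root_.iteratedDerivWithin j y (Icc a b) := by
  cases k with
  | zero =>
    obtain rfl : j = 0 := by omega
    simpa using h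
  | succ k =>
    exact (ae_restrict_iff' measurableSet_Icc).2 (Eventually.of_forall fun t ht =>
      iteratedDerivWithin_congr (hx.eqOn_of_ae hab hy h) ht)

/-- Below the top order the derivatives exist classically, so additivity is pointwise; at the top
order it survives only almost everywhere. -/
theorem MemSobolev.iteratedDerivWithin_add {p a b : ℝ} (hab : a < b) {k : ℕ} {x y : ℝ → ℂ}
    (hx : MemSobolev p a b k x) (hy : MemSobolev p a b k y) {j : ℕ} (hj : j < k) :
    EqOn (_root_.iteratedDerivWithin j (x + y) (Icc a b))
      (_root_.iteratedDerivWithin j x (Icc a b) + _root_.iteratedDerivWithin j y (Icc a b))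
      (Icc a b) := by
  obtain ⟨k, rfl⟩ : ∃ l, k = l + 1 := ⟨k - 1, by omega⟩
  intro t ht
  have hj' : ((j : ℕ) : WithTop ℕ∞) ≤ (k : ℕ) := by norm_cast; omega
  exact _root_.iteratedDerivWithin_add ht (uniqueDiffOn_Icc hab) ((hx.1 t ht).of_le hj')
    ((hy.1 t ht).of_le hj')

theorem MemSobolev.iteratedDerivWithin_add_ae {p a b : ℝ} (hab : a < b) {k : ℕ} {x y : ℝ → ℂ}
    (hx : MemSobolev p a b k x) (hy : MemSobolev p a b k y) {j : ℕ} (hj : j ≤ k) :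
    _root_.iteratedDerivWithin j (x + y) (Icc a b) =ᵐ[volume.restrict (Icc a b)]
      _root_.iteratedDerivWithin j x (Icc a b) + _root_.iteratedDerivWithin j y (Icc a b) := by
  cases j with
  | zero => simp
  | succ j => exact BVP.iteratedDerivWithin_add_ae hab (hx.of_le hab hj) (hy.of_le hab hj)

/-- If `x` is absolutely continuous and `x' = g` almost everywhere with `g ∈ W^k_p`, then
`x ∈ W^{k+1}_p`. -/
theorem MemSobolev.of_deriv {p a b : ℝ} (hp : 1 ≤ p) (hab : a < b) {k : ℕ} {x g : ℝ → ℂ}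
    (hx : AbsolutelyContinuousOnInterval x a b) (hg : MemSobolev p a b k g)
    (h : _root_.derivWithin x (Icc a b) =ᵐ[volume.restrict (Icc a b)] g) :
    MemSobolev p a b (k + 1) x :=
  (hg.primitive hp hab (x a)).congr hab (eq_add_integral_of_absolutelyContinuous hab hx
    (intervalIntegrable_of_memLp hp hab hg.memLp) h).symm

theorem derivWithin_mul_ae {a b : ℝ} (hab : a < b) {u v : ℝ → ℂ}
    (hu : AbsolutelyContinuousOnInterval u a b) (hv : AbsolutelyContinuousOnInterval v a b) :
    derivWithin (u * v) (Icc a b) =ᵐ[volume.restrict (Icc a b)]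
      derivWithin u (Icc a b) * v + u * derivWithin v (Icc a b) := by
  filter_upwards [ae_hasDerivAt_of_absolutelyContinuous hab hu,
    ae_hasDerivAt_of_absolutelyContinuous hab hv, ae_restrict_mem measurableSet_Icc]
    with t h1 h2 ht
  exact (h1.mul h2).hasDerivWithinAt.derivWithin (uniqueDiffOn_Icc hab t ht)

/-! ### L_p norms and the equivalent Sobolev norm `sumN` -/

/-- The `L_p`-norm on `[a,b]` as a real number. -/
def lpN (p a b : ℝ) (u : ℝ → ℂ) : ℝ :=
  (eLpNorm u (ENNReal.ofReal p) (volume.restrict (Icc a b))).toReal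

/-- The sum of the `L_p`-norms of the derivatives of orders `0, …, k`. -/
def sumN (p a b : ℝ) (k : ℕ) (x : ℝ → ℂ) : ℝ :=
  ∑ j ∈ Finset.range (k + 1), lpN p a b (iteratedDerivWithin j x (Icc a b))

theorem lpN_nonneg (p a b : ℝ) (u : ℝ → ℂ) : 0 ≤ lpN p a b u := ENNReal.toReal_nonneg

theorem sumN_nonneg (p a b : ℝ) (k : ℕ) (u : ℝ → ℂ) : 0 ≤ sumN p a b k u :=
  Finset.sum_nonneg fun _ _ => lpN_nonneg _ _ _ _

theorem lpN_congr {p a b : ℝ} {u v : ℝ → ℂ} (h : u =ᵐ[volume.restrict (Icc a b)] v) :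
    lpN p a b u = lpN p a b v := by
  rw [lpN, lpN, eLpNorm_congr_ae h]

theorem lpN_rpow {p a b : ℝ} (hp : 1 ≤ p) (hab : a < b) {u : ℝ → ℂ}
    (hu : MemLp u (ENNReal.ofReal p) (volume.restrict (Icc a b))) :
    lpN p a b u ^ p = ∫ t in a..b, ‖u t‖ ^ p := by
  have hp0 : 0 < p := by linarith
  have hnn : 0 ≤ ∫ t in Icc a b, ‖u t‖ ^ p := integral_nonneg fun t => by positivity
  rw [lpN, hu.eLpNorm_eq_integral_rpow_norm (by simpa using hp0) ENNReal.ofReal_ne_top,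
    ENNReal.toReal_ofReal hp0.le, ENNReal.toReal_ofReal (by positivity),
    Real.rpow_inv_rpow hnn hp0.ne', intervalIntegral.integral_of_le hab.le,
    integral_Icc_eq_integral_Ioc]

theorem lpN_add_le {p a b : ℝ} (hp : 1 ≤ p) {u v : ℝ → ℂ}
    (hu : MemLp u (ENNReal.ofReal p) (volume.restrict (Icc a b)))
    (hv : MemLp v (ENNReal.ofReal p) (volume.restrict (Icc a b))) :
    lpN p a b (u + v) ≤ lpN p a b u + lpN p a b v := by
  rw [lpN, lpN, lpN, ← ENNReal.toReal_add hu.2.ne hv.2.ne]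
  exact ENNReal.toReal_mono (ENNReal.add_ne_top.2 ⟨hu.2.ne, hv.2.ne⟩)
    (eLpNorm_add_le hu.1 hv.1 (ENNReal.one_le_ofReal.2 hp))

theorem lpN_mul_le {p a b : ℝ} {u v : ℝ → ℂ} {C : ℝ}
    (hu : MemLp u (ENNReal.ofReal p) (volume.restrict (Icc a b)))
    (hC : 0 ≤ C) (hv : ∀ t ∈ Icc a b, ‖v t‖ ≤ C) :
    lpN p a b (u * v) ≤ C * lpN p a b u := by
  have h : ∀ᵐ t ∂(volume.restrict (Icc a b)), ‖(u * v) t‖ ≤ C * ‖u t‖ :=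
    (ae_restrict_iff' measurableSet_Icc).2 (Eventually.of_forall fun t ht => by
      rw [Pi.mul_apply, norm_mul, mul_comm]
      exact mul_le_mul_of_nonneg_right (hv t ht) (norm_nonneg _))
  have := eLpNorm_le_mul_eLpNorm_of_ae_le_mul h (ENNReal.ofReal p)
  have h2 := ENNReal.toReal_mono (ENNReal.mul_ne_top ENNReal.ofReal_ne_top hu.2.ne) this
  rwa [ENNReal.toReal_mul, ENNReal.toReal_ofReal hC] at h2

theorem exists_lpN_le_of_bound (p a b : ℝ) : ∃ K : ℝ, 0 ≤ K ∧ ∀ (u : ℝ → ℂ) (C : ℝ), 0 ≤ C →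
    (∀ t ∈ Icc a b, ‖u t‖ ≤ C) → lpN p a b u ≤ K * C := by
  refine ⟨lpN p a b (fun _ => 1), lpN_nonneg _ _ _ _, fun u C hC hu => ?_⟩
  have := lpN_mul_le (p := p) (a := a) (b := b) (u := fun _ => 1) (memLp_const 1) hC hu
  rw [mul_comm]
  convert this using 2
  ext; simp

theorem exists_integral_le_lpN {p a b : ℝ} (hp : 1 ≤ p) (hab : a < b) : ∃ K : ℝ, 0 ≤ K ∧
    ∀ u : ℝ → ℂ, MemLp u (ENNReal.ofReal p) (volume.restrict (Icc a b)) →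
      ∫ t in a..b, ‖u t‖ ≤ K * lpN p a b u := by
  -- Hölder's inequality on a set of finite measure: the constant is `(b - a)^(1 - 1/p)`.
  refine ⟨((volume.restrict (Icc a b)) univ ^ (1 - 1 / p)).toReal, ENNReal.toReal_nonneg,
    fun u hu => ?_⟩
  have h1 := eLpNorm_le_eLpNorm_mul_rpow_measure_univ (ENNReal.one_le_ofReal.2 hp) hu.1
  have hi : MemLp u (ENNReal.ofReal 1) (volume.restrict (Icc a b)) := by
    simpa using hu.mono_exponent (ENNReal.one_le_ofReal.2 hp)
  have h2 := lpN_rpow le_rfl hab hi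
  simp only [Real.rpow_one] at h2
  rw [← h2, lpN, mul_comm, lpN, ← ENNReal.toReal_mul]
  refine ENNReal.toReal_mono ?_ ?_
  · refine ENNReal.mul_ne_top hu.2.ne (ENNReal.rpow_ne_top_of_nonneg ?_ (measure_ne_top _ _))
    have : 1 / p ≤ 1 := by rw [div_le_one (by linarith)]; exact hp
    linarith
  · simpa [ENNReal.toReal_ofReal (by linarith : (0:ℝ) ≤ p)] using h1

theorem sumN_succ (p a b : ℝ) (k : ℕ) (x : ℝ → ℂ) :
    sumN p a b (k + 1) x = lpN p a b x + sumN p a b k (derivWithin x (Icc a b)) := by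
  rw [sumN, Finset.sum_range_succ', iteratedDerivWithin_zero, add_comm, sumN]
  simp only [iteratedDerivWithin_succ']

theorem lpN_le_sumN (p a b : ℝ) {j k : ℕ} (hj : j ≤ k) (x : ℝ → ℂ) :
    lpN p a b (iteratedDerivWithin j x (Icc a b)) ≤ sumN p a b k x :=
  Finset.single_le_sum (f := fun j => lpN p a b (iteratedDerivWithin j x (Icc a b)))
    (fun _ _ => lpN_nonneg _ _ _ _) (Finset.mem_range.2 (by omega))

theorem sumN_le_sumN_succ (p a b : ℝ) (k : ℕ) (x : ℝ → ℂ) :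
    sumN p a b k x ≤ sumN p a b (k + 1) x := by
  rw [sumN, sumN, Finset.sum_range_succ _ (k + 1)]
  linarith [lpN_nonneg p a b (iteratedDerivWithin (k + 1) x (Icc a b))]

theorem sumN_mono (p a b : ℝ) {k l : ℕ} (h : l ≤ k) (x : ℝ → ℂ) :
    sumN p a b l x ≤ sumN p a b k x := by
  induction k, h using Nat.le_induction with
  | base => exact le_rfl
  | succ k _ ih => exact ih.trans (sumN_le_sumN_succ p a b k x)

theorem sumN_derivWithin_le (p a b : ℝ) (k : ℕ) (x : ℝ → ℂ) :
    sumN p a b k (derivWithin x (Icc a b)) ≤ sumN p a b (k + 1) x := by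
  rw [sumN_succ]; linarith [lpN_nonneg p a b x]

theorem sumN_iteratedDerivWithin_le (p a b : ℝ) (k j : ℕ) (x : ℝ → ℂ) :
    sumN p a b k (iteratedDerivWithin j x (Icc a b)) ≤ sumN p a b (k + j) x := by
  induction j generalizing x with
  | zero => simp
  | succ j ih =>
    rw [iteratedDerivWithin_succ']
    exact (ih _).trans (sumN_derivWithin_le p a b (k + j) x)

theorem sumN_congr {p a b : ℝ} (hab : a < b) {k : ℕ} {x y : ℝ → ℂ}
    (hx : MemSobolev p a b k x) (hy : MemSobolev p a b k y)
    (h : x =ᵐ[volume.restrict (Icc a b)] y) : sumN p a b k x = sumN p a b k y :=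
  Finset.sum_congr rfl fun j hj =>
    lpN_congr (hx.iteratedDerivWithin_ae hab hy h (by have := Finset.mem_range.1 hj; omega))

theorem MemSobolev.memLp_iteratedDerivWithin {p a b : ℝ} (hab : a < b) {k j : ℕ} (hj : j ≤ k)
    {x : ℝ → ℂ} (hx : MemSobolev p a b k x) :
    MemLp (_root_.iteratedDerivWithin j x (Icc a b)) (ENNReal.ofReal p)
      (volume.restrict (Icc a b)) := by
  have h0 : MemSobolev p a b (0 + j) x := hx.of_le hab (by omega)
  exact MemSobolev.iteratedDerivWithin hab h0

theorem sumN_add_le {p a b : ℝ} (hp : 1 ≤ p) (hab : a < b) {k : ℕ} {x y : ℝ → ℂ}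
    (hx : MemSobolev p a b k x) (hy : MemSobolev p a b k y) :
    sumN p a b k (x + y) ≤ sumN p a b k x + sumN p a b k y := by
  rw [sumN, sumN, sumN, ← Finset.sum_add_distrib]
  refine Finset.sum_le_sum fun j hj => ?_
  have hj' : j ≤ k := by have := Finset.mem_range.1 hj; omega
  rw [lpN_congr (hx.iteratedDerivWithin_add_ae hab hy hj')]
  exact lpN_add_le hp (hx.memLp_iteratedDerivWithin hab hj')
    (hy.memLp_iteratedDerivWithin hab hj')

theorem sobolevNorm_eq {p a b : ℝ} (hp : 1 ≤ p) (hab : a < b) {k : ℕ} {x : ℝ → ℂ}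
    (hx : MemSobolev p a b k x) : sobolevNorm p a b k x =
      (∑ j ∈ Finset.range (k + 1), lpN p a b (iteratedDerivWithin j x (Icc a b)) ^ p)
        ^ (1 / p) := by
  rw [sobolevNorm]
  congr 1
  refine Finset.sum_congr rfl fun j hj => ?_
  rw [lpN_rpow hp hab (hx.memLp_iteratedDerivWithin hab
    (by have := Finset.mem_range.1 hj; omega))]

/-- The `ℓ^p` norm of finitely many nonnegative numbers is at most their sum `S`, since each of them
satisfies `c^p ≤ c * S^(p-1)`. -/
theorem sobolevNorm_le_sumN {p a b : ℝ} (hp : 1 ≤ p) (hab : a < b) {k : ℕ} {x : ℝ → ℂ}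
    (hx : MemSobolev p a b k x) : sobolevNorm p a b k x ≤ sumN p a b k x := by
  have hp0 : 0 < p := by linarith
  rw [sobolevNorm_eq hp hab hx]
  have hS := sumN_nonneg p a b k x
  have : ∑ j ∈ Finset.range (k + 1), lpN p a b (iteratedDerivWithin j x (Icc a b)) ^ p
      ≤ sumN p a b k x ^ p := by
    have e : sumN p a b k x ^ p = ∑ j ∈ Finset.range (k + 1),
        lpN p a b (iteratedDerivWithin j x (Icc a b)) * sumN p a b k x ^ (p - 1) := by
      rw [← Finset.sum_mul]
      change _ = sumN p a b k x * _
      rcases hS.eq_or_lt with h | h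
      · rw [← h, Real.zero_rpow hp0.ne', zero_mul]
      · rw [Real.rpow_sub_one h.ne']; field_simp
    rw [e]
    refine Finset.sum_le_sum fun j hj => ?_
    have h1 := lpN_nonneg p a b (iteratedDerivWithin j x (Icc a b))
    have h2 := lpN_le_sumN p a b (Nat.lt_succ_iff.1 (Finset.mem_range.1 hj)) x
    rcases h1.eq_or_lt with h | h
    · rw [← h, Real.zero_rpow hp0.ne', zero_mul]
    · calc _ = lpN p a b (iteratedDerivWithin j x (Icc a b)) *
            lpN p a b (iteratedDerivWithin j x (Icc a b)) ^ (p - 1) := by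
              rw [Real.rpow_sub_one h.ne']; field_simp
        _ ≤ _ := mul_le_mul_of_nonneg_left (Real.rpow_le_rpow h1 h2 (by linarith)) h1
  calc _ ≤ (sumN p a b k x ^ p) ^ (1 / p) :=
        Real.rpow_le_rpow (Finset.sum_nonneg fun j _ => Real.rpow_nonneg (lpN_nonneg _ _ _ _) _)
          this (by positivity)
    _ = _ := by rw [one_div, Real.rpow_rpow_inv hS hp0.ne']

theorem sumN_le_sobolevNorm {p a b : ℝ} (hp : 1 ≤ p) (hab : a < b) {k : ℕ} {x : ℝ → ℂ}
    (hx : MemSobolev p a b k x) : sumN p a b k x ≤ (k + 1) * sobolevNorm p a b k x := by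
  have hp0 : 0 < p := by linarith
  rw [sobolevNorm_eq hp hab hx]
  refine (Finset.sum_le_card_nsmul _ _ _ fun j hj => ?_).trans_eq (by
    rw [Finset.card_range, nsmul_eq_mul]; push_cast; rfl)
  have h1 := lpN_nonneg p a b (iteratedDerivWithin j x (Icc a b))
  rw [← Real.rpow_rpow_inv h1 hp0.ne', one_div]
  refine Real.rpow_le_rpow (by positivity) ?_ (by positivity)
  exact Finset.single_le_sum
    (f := fun j => lpN p a b (iteratedDerivWithin j x (Icc a b)) ^ p)
    (fun j _ => Real.rpow_nonneg (lpN_nonneg _ _ _ _) _) hj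

/-! ### Embedding, products, and estimates from initial data -/

/-- The values on `[a,b]` of a function of class `W^1_p` are controlled by the initial value and
the norm of the derivative. -/
theorem exists_norm_le_initial {p a b : ℝ} (hp : 1 ≤ p) (hab : a < b) : ∃ K : ℝ, 0 ≤ K ∧
    ∀ (k : ℕ) (x : ℝ → ℂ), MemSobolev p a b (k + 1) x → ∀ s ∈ Icc a b, ∀ t ∈ Icc a b,
      ‖x t‖ ≤ ‖x s‖ + K * lpN p a b (derivWithin x (Icc a b)) := by
  obtain ⟨K, hK, h⟩ := exists_integral_le_lpN hp hab
  refine ⟨K, hK, fun k x hx s hs t ht => ?_⟩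
  have hm := (hx.derivWithin hab).memLp
  have hi := intervalIntegrable_of_memLp hp hab hm
  have ha : a ∈ uIcc a b := left_mem_uIcc
  rw [← uIcc_of_le hab.le] at hs ht
  have e : x t = x s + ∫ τ in s..t, derivWithin x (Icc a b) τ := by
    have h1 := hx.eqOn_primitive hp hab (by rwa [← uIcc_of_le hab.le] : s ∈ Icc a b)
    have h2 := hx.eqOn_primitive hp hab (by rwa [← uIcc_of_le hab.le] : t ∈ Icc a b)
    simp only at h1 h2
    rw [h1, h2, ← intervalIntegral.integral_interval_sub_left
      (hi.mono_set (uIcc_subset_uIcc ha ht)) (hi.mono_set (uIcc_subset_uIcc ha hs))]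
    ring
  rw [e]
  refine (norm_add_le _ _).trans (add_le_add le_rfl ?_)
  refine le_trans ?_ (h _ hm)
  refine intervalIntegral.norm_integral_le_abs_integral_norm.trans ?_
  rw [← abs_of_nonneg (a := ∫ t in a..b, ‖derivWithin x (Icc a b) t‖)
    (intervalIntegral.integral_nonneg hab.le fun _ _ => norm_nonneg _)]
  exact intervalIntegral.abs_integral_mono_interval
    (uIoc_subset_uIoc_of_uIcc_subset_uIcc (uIcc_subset_uIcc hs ht))
    (Eventually.of_forall fun _ => norm_nonneg _) hi.norm

/-- Embedding of `W^1_p` into the continuous functions. -/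
theorem exists_norm_le_sumN {p a b : ℝ} (hp : 1 ≤ p) (hab : a < b) : ∃ K : ℝ, 0 ≤ K ∧
    ∀ (k : ℕ) (x : ℝ → ℂ), MemSobolev p a b (k + 1) x → ∀ t ∈ Icc a b,
      ‖x t‖ ≤ K * sumN p a b (k + 1) x := by
  obtain ⟨K, hK, h⟩ := exists_norm_le_initial hp hab
  obtain ⟨K', hK', h'⟩ := exists_integral_le_lpN hp hab
  have hba : 0 < b - a := sub_pos.2 hab
  refine ⟨K' / (b - a) + K, by positivity, fun k x hx t ht => ?_⟩
  set D := lpN p a b (derivWithin x (Icc a b)) with hD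
  -- Integrate over `s` the inequality `‖x t‖ - K * D ≤ ‖x s‖`, valid for every `s` in `[a,b]`.
  have h1 : (b - a) * (‖x t‖ - K * D) ≤ K' * lpN p a b x := by
    refine le_trans ?_ (h' _ hx.memLp)
    have : ∫ s in a..b, (‖x t‖ - K * D) ≤ ∫ s in a..b, ‖x s‖ := by
      refine intervalIntegral.integral_mono_on hab.le (by simp)
        (intervalIntegrable_of_memLp hp hab hx.memLp).norm fun s hs => ?_
      linarith [h k x hx s hs t ht]
    rwa [intervalIntegral.integral_const, smul_eq_mul] at this
  have h2 : ‖x t‖ ≤ K' / (b - a) * lpN p a b x + K * D := by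
    have : ‖x t‖ - K * D ≤ K' * lpN p a b x / (b - a) := by
      rw [le_div_iff₀ hba]; linarith
    rw [div_mul_eq_mul_div]; linarith
  refine h2.trans ?_
  rw [add_mul]
  have e0 : lpN p a b x ≤ sumN p a b (k + 1) x := by
    simpa using lpN_le_sumN p a b (Nat.zero_le (k + 1)) x
  have e1 : D ≤ sumN p a b (k + 1) x := by
    simpa [iteratedDerivWithin_succ'] using lpN_le_sumN p a b (j := 1) (by omega : 1 ≤ k + 1) x
  gcongr

theorem memLp_mul_continuousOn {p a b : ℝ} {u v : ℝ → ℂ}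
    (hu : MemLp u (ENNReal.ofReal p) (volume.restrict (Icc a b))) (hv : ContinuousOn v (Icc a b)) :
    MemLp (u * v) (ENNReal.ofReal p) (volume.restrict (Icc a b)) := by
  obtain ⟨C, hC⟩ := isCompact_Icc.exists_bound_of_continuousOn hv
  have hvi : MemLp v ⊤ (volume.restrict (Icc a b)) :=
    memLp_top_of_bound (hv.aestronglyMeasurable measurableSet_Icc) C
      ((ae_restrict_iff' measurableSet_Icc).2 (Eventually.of_forall hC))
  exact MemLp.mul hvi hu

/-- The product of functions of the classes `W^k_p` and `W^{k+1}_p` belongs to `W^k_p`, with a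
bound for its norm. -/
theorem exists_sumN_mul_le {p a b : ℝ} (hp : 1 ≤ p) (hab : a < b) (k : ℕ) : ∃ K : ℝ, 0 ≤ K ∧
    ∀ u v : ℝ → ℂ, MemSobolev p a b k u → MemSobolev p a b (k + 1) v →
      MemSobolev p a b k (u * v) ∧
        sumN p a b k (u * v) ≤ K * (sumN p a b k u * sumN p a b (k + 1) v) := by
  obtain ⟨K₀, hK₀, h₀⟩ := exists_norm_le_sumN hp hab
  have hlp : ∀ (l : ℕ) (u v : ℝ → ℂ), MemLp u (ENNReal.ofReal p) (volume.restrict (Icc a b)) →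
      MemSobolev p a b (l + 1) v → lpN p a b (u * v) ≤ K₀ * sumN p a b (l + 1) v * lpN p a b u :=
    fun l u v hu hv => lpN_mul_le hu (mul_nonneg hK₀ (sumN_nonneg _ _ _ _ _)) (h₀ l v hv)
  induction k with
  | zero =>
    refine ⟨K₀, hK₀, fun u v hu hv => ⟨?_, ?_⟩⟩
    -- Here `u` is only in `L_p`, so `v` must be bounded; this is what the extra derivative of `v`
    -- pays for.
    · exact memLp_mul_continuousOn hu hv.continuousOn
    · have := hlp 0 u v hu hv
      simp only [sumN, zero_add, Finset.range_one, Finset.sum_singleton,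
        iteratedDerivWithin_zero] at this ⊢
      linarith
  | succ k ih =>
    obtain ⟨K, hK, ih⟩ := ih
    refine ⟨K₀ + K + K, by positivity, fun u v hu hv => ?_⟩
    -- Leibniz' rule `(u * v)' = u' * v + u * v'`: each summand is again a product of orders `k` and
    -- `k + 1`.
    obtain ⟨m1, n1⟩ := ih _ v (hu.derivWithin hab) (hv.of_succ hab)
    obtain ⟨m2, n2⟩ := ih u _ (hu.of_succ hab) (hv.derivWithin hab)
    have hac := hu.absolutelyContinuous hab |>.smul (hv.absolutelyContinuous hab)
    rw [smul_eq_mul] at hac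
    have hd := derivWithin_mul_ae hab (hu.absolutelyContinuous hab) (hv.absolutelyContinuous hab)
    have hm : MemSobolev p a b (k + 1) (u * v) := MemSobolev.of_deriv hp hab hac (m1.add hab m2) hd
    refine ⟨hm, ?_⟩
    rw [sumN_succ, sumN_congr hab (hm.derivWithin hab) (m1.add hab m2) hd]
    have hu0 := sumN_nonneg p a b (k + 1) u
    have hv0 := sumN_nonneg p a b (k + 2) v
    have b1 := hlp (k + 1) u v hu.memLp hv
    have b2 : lpN p a b u ≤ sumN p a b (k + 1) u := by
      simpa using lpN_le_sumN p a b (Nat.zero_le (k + 1)) u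
    have c0 : lpN p a b (u * v) ≤ K₀ * (sumN p a b (k + 1) u * sumN p a b (k + 2) v) :=
      b1.trans (by rw [mul_assoc, mul_comm (sumN p a b (k + 2) v)]; gcongr)
    have c1 : sumN p a b k (derivWithin u (Icc a b) * v)
        ≤ K * (sumN p a b (k + 1) u * sumN p a b (k + 2) v) := by
      refine n1.trans (mul_le_mul_of_nonneg_left (mul_le_mul (sumN_derivWithin_le _ _ _ _ _)
        (sumN_le_sumN_succ _ _ _ _ _) (sumN_nonneg _ _ _ _ _) hu0) hK)
    have c2 : sumN p a b k (u * derivWithin v (Icc a b))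
        ≤ K * (sumN p a b (k + 1) u * sumN p a b (k + 2) v) := by
      refine n2.trans (mul_le_mul_of_nonneg_left (mul_le_mul (sumN_le_sumN_succ _ _ _ _ _)
        (sumN_derivWithin_le _ _ _ _ _) (sumN_nonneg _ _ _ _ _) hu0) hK)
    have := sumN_add_le hp hab m1 m2
    linarith

/-- Both summands of Leibniz' rule pair a factor of order `k - 1` with one of order `k`, so the
mixed product result applies to each. The algebra property feeds the regularity bootstrap in
`exists_cauchy`. -/
theorem MemSobolev.mul {p a b : ℝ} (hp : 1 ≤ p) (hab : a < b) {k : ℕ} {u v : ℝ → ℂ}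
    (hu : MemSobolev p a b k u) (hv : MemSobolev p a b k v) (hk : 1 ≤ k) :
    MemSobolev p a b k (u * v) := by
  obtain ⟨k, rfl⟩ : ∃ l, k = l + 1 := ⟨k - 1, by omega⟩
  obtain ⟨K, -, h⟩ := exists_sumN_mul_le hp hab k
  have m1 := (h _ v (hu.derivWithin hab) hv).1
  have m2 := (h _ u (hv.derivWithin hab) hu).1
  rw [mul_comm] at m2
  have hac := hu.absolutelyContinuous hab |>.smul (hv.absolutelyContinuous hab)
  exact MemSobolev.of_deriv hp hab hac (m1.add hab m2)
    (derivWithin_mul_ae hab (hu.absolutelyContinuous hab) (hv.absolutelyContinuous hab))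

/-- Integrate back from the top derivative: the initial value and the `L_p` norm of `x'` bound `x`
uniformly, hence in `L_p`. This is what bounds the Sobolev norm by `‖toData y‖`. -/
theorem exists_sumN_le_data {p a b : ℝ} (hp : 1 ≤ p) (hab : a < b) (k : ℕ) : ∃ K : ℝ, 0 ≤ K ∧
    ∀ (x : ℝ → ℂ) (ρ : ℝ), MemSobolev p a b k x →
      (∀ j < k, ‖iteratedDerivWithin j x (Icc a b) a‖ ≤ ρ) →
      lpN p a b (iteratedDerivWithin k x (Icc a b)) ≤ ρ → sumN p a b k x ≤ K * ρ := by
  obtain ⟨K₀, hK₀, h₀⟩ := exists_norm_le_initial hp hab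
  obtain ⟨K₁, hK₁, h₁⟩ := exists_lpN_le_of_bound p a b
  induction k with
  | zero => exact ⟨1, zero_le_one, fun x ρ _ _ h => by simpa [sumN] using h⟩
  | succ k ih =>
    obtain ⟨K, hK, ih⟩ := ih
    refine ⟨K₁ * (1 + K₀ * K) + K, by positivity, fun x ρ hx hj hl => ?_⟩
    have hx' := hx.derivWithin hab
    have hs := ih _ ρ hx' (fun j hjk => by
      rw [← iteratedDerivWithin_succ']; exact hj (j + 1) (by omega))
      (by rw [← iteratedDerivWithin_succ']; exact hl)
    have hρ : 0 ≤ ρ := (lpN_nonneg _ _ _ _).trans hl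
    have h2 : lpN p a b (derivWithin x (Icc a b)) ≤ K * ρ :=
      le_trans (by simpa using lpN_le_sumN p a b (Nat.zero_le k) (derivWithin x (Icc a b))) hs
    have h3 : lpN p a b x ≤ K₁ * ((1 + K₀ * K) * ρ) := by
      refine h₁ x _ (by positivity) fun t ht => ?_
      have h4 := h₀ k x hx a (left_mem_Icc.2 hab.le) t ht
      have h5 := hj 0 (by omega)
      rw [iteratedDerivWithin_zero] at h5
      nlinarith [mul_le_mul_of_nonneg_left h2 hK₀]
    rw [sumN_succ]
    linarith

/-- Repeated integration starting from `g`; it makes `toData` surjective. -/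
theorem exists_memSobolev_data {p a b : ℝ} (hp : 1 ≤ p) (hab : a < b) (k : ℕ) (c : ℕ → ℂ)
    {g : ℝ → ℂ} (hg : MemLp g (ENNReal.ofReal p) (volume.restrict (Icc a b))) :
    ∃ x, MemSobolev p a b k x ∧ (∀ j < k, iteratedDerivWithin j x (Icc a b) a = c j) ∧
      iteratedDerivWithin k x (Icc a b) =ᵐ[volume.restrict (Icc a b)] g := by
  induction k generalizing c with
  | zero => exact ⟨g, hg, by simp, by simp⟩
  | succ k ih =>
    obtain ⟨y, hy, hc, hyg⟩ := ih fun j => c (j + 1)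
    have hi := intervalIntegrable_of_memLp hp hab hy.memLp
    have hx := hy.primitive hp hab (c 0)
    have hd := derivWithin_primitive_ae hab hi (c 0)
    refine ⟨_, hx, fun j hj => ?_, ?_⟩
    · cases j with
      | zero => simp
      | succ j =>
        -- Here `k ≥ 1`, so both functions are continuous and their almost everywhere equality
        -- extends to the point `a`.
        obtain ⟨l, rfl⟩ : ∃ l, k = l + 1 := ⟨k - 1, by omega⟩
        rw [iteratedDerivWithin_succ', ← hc j (by omega)]
        exact iteratedDerivWithin_congr ((hx.derivWithin hab).eqOn_of_ae hab hy hd)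
          (left_mem_Icc.2 hab.le)
    · rw [iteratedDerivWithin_succ']
      exact ((hx.derivWithin hab).iteratedDerivWithin_ae hab hy hd le_rfl).trans hyg

theorem sobolevNorm_nonneg (p : ℝ) {a b : ℝ} (hab : a < b) (k : ℕ) (x : ℝ → ℂ) :
    0 ≤ sobolevNorm p a b k x :=
  Real.rpow_nonneg (Finset.sum_nonneg fun _ _ =>
    intervalIntegral.integral_nonneg hab.le fun _ _ => Real.rpow_nonneg (norm_nonneg _) _) _

theorem vecNorm_nonneg (p : ℝ) {a b : ℝ} (hab : a < b) (k : ℕ) {m : ℕ} (x : ℝ → Fin m → ℂ) :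
    0 ≤ vecNorm p a b k x :=
  Finset.sum_nonneg fun _ _ => sobolevNorm_nonneg p hab k _

/-! ### A Banach space model of (W^k_p)^m -/

section Model

variable {a b : ℝ} {hab : a < b} {p : ℝ} {k m : ℕ}

/-- A Banach space isomorphic to `(W^k_p)^m`: for each component, the initial values of the
derivatives of orders less than `k`, and the derivative of order `k` in `L_p`. -/
abbrev SobolevData (p a b : ℝ) (k m : ℕ) : Type :=
  Fin m → (Fin k → ℂ) × Lp ℂ (ENNReal.ofReal p) (volume.restrict (Icc a b))

/-- The initial values and the highest derivative of a function of class `(W^k_p)^m`. -/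
def toData : SobolevVec hab p k m →ₗ[ℂ] SobolevData p a b k m where
  toFun y i :=
    (fun j => iteratedDerivWithin j (fun t => (y : ℝ → Fin m → ℂ) t i) (Icc a b) a,
      ((y.2 i).memLp_iteratedDerivWithin hab le_rfl).toLp)
  map_add' x y := by
    funext i
    refine Prod.ext (funext fun j => ?_) ?_
    · exact MemSobolev.iteratedDerivWithin_add hab (x.2 i) (y.2 i) j.2 (left_mem_Icc.2 hab.le)
    · simp only [Pi.add_apply, Prod.snd_add, ← MemLp.toLp_add]
      exact MemLp.toLp_congr _ _ (MemSobolev.iteratedDerivWithin_add_ae hab (x.2 i) (y.2 i) le_rfl)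
  map_smul' c x := by
    funext i
    refine Prod.ext (funext fun j => ?_) ?_
    · exact iteratedDerivWithin_const_smul_field c fun t => (x : ℝ → Fin m → ℂ) t i
    · simp only [RingHom.id_apply, Pi.smul_apply, Prod.smul_snd, ← MemLp.toLp_const_smul]
      exact MemLp.toLp_congr _ _ (Eventually.of_forall fun t =>
        iteratedDerivWithin_const_smul_field c fun t => (x : ℝ → Fin m → ℂ) t i)

theorem norm_toData_snd (y : SobolevVec hab p k m) (i : Fin m) : ‖(toData y i).2‖ =
    lpN p a b (iteratedDerivWithin k (fun t => (y : ℝ → Fin m → ℂ) t i) (Icc a b)) :=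
  Lp.norm_toLp _ ((y.2 i).memLp_iteratedDerivWithin hab le_rfl)

/-- For `k ≥ 1` both sides are continuous, so the pointwise and the almost everywhere form of an
equation agree. -/
theorem eqSobolev_iff {y z : ℝ → Fin m → ℂ} (hy : y ∈ SobolevVec hab p k m)
    (hz : z ∈ SobolevVec hab p k m) : EqSobolev a b k y z ↔
      ∀ i, (fun t => y t i) =ᵐ[volume.restrict (Icc a b)] fun t => z t i := by
  rw [EqSobolev]
  split_ifs with hk
  · simp only [funext_iff, eventually_all]
    rfl
  · obtain ⟨l, rfl⟩ : ∃ l, k = l + 1 := ⟨k - 1, by omega⟩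
    refine ⟨fun h i => (ae_restrict_iff' measurableSet_Icc).2 (Eventually.of_forall fun t ht =>
      congrFun (h t ht) i), fun h t ht => funext fun i => ?_⟩
    exact (hy i).eqOn_of_ae hab (hz i) (h i) ht

variable [Fact (1 ≤ ENNReal.ofReal p)]

theorem one_le_of_fact {p : ℝ} [Fact (1 ≤ ENNReal.ofReal p)] : 1 ≤ p :=
  ENNReal.one_le_ofReal.1 (Fact.out : 1 ≤ ENNReal.ofReal p)

theorem sumN_le_vecNorm (y : SobolevVec hab p k m) (i : Fin m) :
    sumN p a b k (fun t => (y : ℝ → Fin m → ℂ) t i) ≤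
      (k + 1) * vecNorm p a b k (y : ℝ → Fin m → ℂ) :=
  (sumN_le_sobolevNorm one_le_of_fact hab (y.2 i)).trans
    (mul_le_mul_of_nonneg_left (Finset.single_le_sum
      (f := fun i => sobolevNorm p a b k (fun t => (y : ℝ → Fin m → ℂ) t i))
      (fun i _ => sobolevNorm_nonneg p hab k _) (Finset.mem_univ i)) (by positivity))

theorem exists_norm_toData_le_sumN (hab : a < b) (p : ℝ) (k m : ℕ)
    [Fact (1 ≤ ENNReal.ofReal p)] : ∃ K : ℝ, 0 ≤ K ∧
    ∀ (y : SobolevVec hab p k m) (ρ : ℝ), 0 ≤ ρ →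
      (∀ i, sumN p a b k (fun t => (y : ℝ → Fin m → ℂ) t i) ≤ ρ) → ‖toData y‖ ≤ K * ρ := by
  obtain ⟨K₀, hK₀, h₀⟩ := exists_norm_le_sumN (p := p) one_le_of_fact hab
  refine ⟨max K₀ 1, by positivity, fun y ρ hρ hy => ?_⟩
  refine (pi_norm_le_iff_of_nonneg (by positivity)).2 fun i => ?_
  rw [Prod.norm_def]
  refine max_le ((pi_norm_le_iff_of_nonneg (by positivity)).2 fun j => ?_) ?_
  · have hj := j.2
    -- Since `j < k`, the derivative of order `j` keeps at least one order of smoothness, which the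
    -- embedding needs to bound its value at `a`.
    obtain ⟨l, hl⟩ : ∃ l, k = (l + 1) + j := ⟨k - 1 - j, by omega⟩
    have hm := MemSobolev.iteratedDerivWithin hab (k := l + 1) (j := j)
      ((y.2 i).of_le hab (le_of_eq hl.symm))
    refine (h₀ l _ hm a (left_mem_Icc.2 hab.le)).trans ?_
    refine mul_le_mul (le_max_left _ _) ?_ (sumN_nonneg _ _ _ _ _) (by positivity)
    refine (sumN_iteratedDerivWithin_le p a b (l + 1) j _).trans ?_
    rw [← hl]
    exact hy i
  · rw [norm_toData_snd]
    refine (lpN_le_sumN p a b le_rfl _).trans ((hy i).trans ?_)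
    exact le_mul_of_one_le_left hρ (le_max_right _ _)

theorem exists_sumN_le_norm_toData (hab : a < b) (p : ℝ) (k m : ℕ)
    [Fact (1 ≤ ENNReal.ofReal p)] : ∃ K : ℝ, 0 ≤ K ∧
    ∀ (y : SobolevVec hab p k m) (i : Fin m),
      sumN p a b k (fun t => (y : ℝ → Fin m → ℂ) t i) ≤ K * ‖toData y‖ := by
  obtain ⟨K, hK, h⟩ := exists_sumN_le_data (p := p) one_le_of_fact hab k
  refine ⟨K, hK, fun y i => h _ _ (y.2 i) (fun j hj => ?_) ?_⟩
  · exact (norm_le_pi_norm (toData y i).1 ⟨j, hj⟩).trans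
      ((norm_fst_le _).trans (norm_le_pi_norm (toData y) i))
  · rw [← norm_toData_snd]
    exact (norm_snd_le _).trans (norm_le_pi_norm (toData y) i)

theorem exists_norm_toData_le (hab : a < b) (p : ℝ) (k m : ℕ)
    [Fact (1 ≤ ENNReal.ofReal p)] : ∃ K : ℝ, 0 < K ∧
    ∀ y : SobolevVec hab p k m, ‖toData y‖ ≤ K * vecNorm p a b k (y : ℝ → Fin m → ℂ) := by
  obtain ⟨K, hK, h⟩ := exists_norm_toData_le_sumN hab p k m
  refine ⟨K * (k + 1) + 1, by positivity, fun y => ?_⟩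
  have hn := vecNorm_nonneg p hab k (y : ℝ → Fin m → ℂ)
  have := h y _ (mul_nonneg (by positivity) hn) (sumN_le_vecNorm y)
  linarith

theorem exists_vecNorm_le (hab : a < b) (p : ℝ) (k m : ℕ)
    [Fact (1 ≤ ENNReal.ofReal p)] : ∃ K : ℝ, 0 < K ∧
    ∀ y : SobolevVec hab p k m, vecNorm p a b k (y : ℝ → Fin m → ℂ) ≤ K * ‖toData y‖ := by
  obtain ⟨K, hK, h⟩ := exists_sumN_le_norm_toData hab p k m
  refine ⟨m * K + 1, by positivity, fun y => ?_⟩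
  have h1 : vecNorm p a b k (y : ℝ → Fin m → ℂ) ≤ ∑ _i : Fin m, K * ‖toData y‖ :=
    Finset.sum_le_sum fun i _ =>
      (sobolevNorm_le_sumN one_le_of_fact hab (y.2 i)).trans (h y i)
  rw [Finset.sum_const, Finset.card_univ, Fintype.card_fin, nsmul_eq_mul] at h1
  linarith [norm_nonneg (toData y)]

theorem toData_surjective :
    Function.Surjective (toData : SobolevVec hab p k m →ₗ[ℂ] SobolevData p a b k m) := by
  intro d
  choose x hx hc hg using fun i : Fin m => exists_memSobolev_data (p := p) one_le_of_fact hab k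
    (fun j => if h : j < k then (d i).1 ⟨j, h⟩ else 0) (Lp.memLp (d i).2)
  refine ⟨⟨fun t i => x i t, hx⟩, funext fun i => Prod.ext (funext fun j => ?_) ?_⟩
  · refine (hc i j j.2).trans ?_
    rw [dif_pos j.2]
  · exact (MemLp.toLp_congr ((hx i).memLp_iteratedDerivWithin hab le_rfl)
      (Lp.memLp (d i).2) (hg i)).trans (Lp.toLp_coeFn _ _)

theorem toData_eq_iff {y z : SobolevVec hab p k m} : toData y = toData z ↔
    ∀ i, (fun t => (y : ℝ → Fin m → ℂ) t i) =ᵐ[volume.restrict (Icc a b)]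
      fun t => (z : ℝ → Fin m → ℂ) t i := by
  constructor
  · intro h i
    obtain ⟨K, hK, hKy⟩ := exists_sumN_le_norm_toData hab p k m
    have h0 := hKy (y - z) i
    rw [map_sub, h, sub_self, norm_zero, mul_zero] at h0
    have h1 := (lpN_le_sumN p a b (Nat.zero_le k) _).trans h0
    rw [iteratedDerivWithin_zero] at h1
    have h2 := le_antisymm h1 (lpN_nonneg _ _ _ _)
    have hm := ((y - z).2 i).memLp
    rw [lpN, ENNReal.toReal_eq_zero_iff] at h2
    have h3 := h2.resolve_right hm.2.ne
    rw [eLpNorm_eq_zero_iff hm.1 (fun h => by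
      have : (1 : ENNReal) ≤ ENNReal.ofReal p := Fact.out
      rw [h] at this; simp at this)] at h3
    filter_upwards [h3] with t ht
    exact sub_eq_zero.1 ht
  · intro h
    refine funext fun i => Prod.ext (funext fun j => ?_) ?_
    · have hj := j.2
      have hy : MemSobolev p a b (k - 1 + 1) (fun t => (y : ℝ → Fin m → ℂ) t i) :=
        (y.2 i).of_le hab (by omega)
      have hz : MemSobolev p a b (k - 1 + 1) (fun t => (z : ℝ → Fin m → ℂ) t i) :=
        (z.2 i).of_le hab (by omega)
      exact iteratedDerivWithin_congr (hy.eqOn_of_ae hab hz (h i)) (left_mem_Icc.2 hab.le)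
    · exact MemLp.toLp_congr ((y.2 i).memLp_iteratedDerivWithin hab le_rfl)
        ((z.2 i).memLp_iteratedDerivWithin hab le_rfl)
        ((y.2 i).iteratedDerivWithin_ae hab (z.2 i) (h i) le_rfl)

theorem toData_eq_iff_eqSobolev {y z : SobolevVec hab p k m} : toData y = toData z ↔
    EqSobolev a b k (y : ℝ → Fin m → ℂ) z := by
  rw [toData_eq_iff, eqSobolev_iff y.2 z.2]

theorem toData_eq_iff_eqOn (hk : k ≠ 0) {y z : SobolevVec hab p k m} : toData y = toData z ↔
    EqOn (y : ℝ → Fin m → ℂ) z (Icc a b) := by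
  rw [toData_eq_iff_eqSobolev, EqSobolev, if_neg hk]
  rfl

/-- A linear map that is bounded for the Sobolev norm factors through `toData`. -/
theorem exists_continuousLinearMap {Z : Type*} [NormedAddCommGroup Z] [NormedSpace ℂ Z]
    (T : SobolevVec hab p k m →ₗ[ℂ] Z) {C : ℝ}
    (hT : ∀ y, ‖T y‖ ≤ C * vecNorm p a b k (y : ℝ → Fin m → ℂ)) :
    ∃ S : SobolevData p a b k m →L[ℂ] Z, ∀ y, S (toData y) = T y := by
  obtain ⟨K, hK, h⟩ := exists_vecNorm_le hab p k m
  -- Any linear section of `toData` will do, continuous or not: the bound on `T` turns into one by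
  -- `‖toData y‖`, which also makes `T` vanish on the kernel of `toData`.
  obtain ⟨J, hJ⟩ := (toData : SobolevVec hab p k m →ₗ[ℂ] _).exists_rightInverse_of_surjective
    (LinearMap.range_eq_top.2 toData_surjective)
  have hJ' : ∀ d, toData (J d) = d := fun d => LinearMap.congr_fun hJ d
  have hb : ∀ y, ‖T y‖ ≤ |C| * K * ‖toData y‖ := fun y => by
    refine (hT y).trans ?_
    rw [mul_assoc]
    exact mul_le_mul (le_abs_self C) (h y) (vecNorm_nonneg p hab k _) (abs_nonneg C)
  refine ⟨(T ∘ₗ J).mkContinuous (|C| * K) fun d => ?_, fun y => ?_⟩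
  · have := hb (J d)
    rwa [hJ'] at this
  · have := hb (J (toData y) - y)
    rw [map_sub, map_sub, hJ', sub_self, norm_zero, mul_zero] at this
    exact sub_eq_zero.1 (norm_le_zero_iff.1 this)

end Model

/-! ### Stability of invertibility under mixed norm and strong convergence -/

/-- The uniform boundedness principle along a countably generated filter. -/
theorem eventually_norm_le_of_tendsto {ι X F : Type*} [NormedAddCommGroup X] [NormedSpace ℂ X]
    [CompleteSpace X] [NormedAddCommGroup F] [NormedSpace ℂ F] {l : Filter ι}
    [l.IsCountablyGenerated] {B : ι → X →L[ℂ] F} {B₀ : X →L[ℂ] F}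
    (hB : ∀ x, Tendsto (fun i => B i x) l (𝓝 (B₀ x))) : ∃ M : ℝ, ∀ᶠ i in l, ‖B i‖ ≤ M := by
  by_contra! h
  obtain ⟨s, hs⟩ := l.exists_antitone_basis
  -- If no bound holds eventually, the `n`-th set of a countable basis contains an index with norm
  -- above `n`; strong convergence along this sequence contradicts Banach–Steinhaus.
  have hex : ∀ n : ℕ, ∃ i ∈ s n, (n : ℝ) < ‖B i‖ := fun n => by
    obtain ⟨i, hi, his⟩ := ((h n).and_eventually (hs.1.mem_of_mem trivial)).exists
    exact ⟨i, his, hi⟩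
  choose u hus hu using hex
  have ht := hs.tendsto hus
  obtain ⟨C, hC⟩ := banach_steinhaus (g := fun n => B (u n)) fun x => by
    obtain ⟨C, hC⟩ := (((hB x).comp ht).norm).bddAbove_range
    exact ⟨C, fun n => hC ⟨n, rfl⟩⟩
  obtain ⟨n, hn⟩ := exists_nat_gt C
  linarith [hC n, hu n]

/-- In coordinates `K i` is a finite sum of rank-one operators, whose norms are controlled by the
vectors `K i (e j)`. -/
theorem tendsto_zero_of_forall_tendsto_zero {ι E F : Type*} [NormedAddCommGroup E]
    [NormedSpace ℂ E] [FiniteDimensional ℂ E] [NormedAddCommGroup F] [NormedSpace ℂ F]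
    {l : Filter ι} {K : ι → E →L[ℂ] F} (hK : ∀ x, Tendsto (fun i => K i x) l (𝓝 0)) :
    Tendsto K l (𝓝 0) := by
  set e := Module.finBasis ℂ E
  have h : ∀ i, K i = ∑ j, (LinearMap.toContinuousLinearMap (e.coord j)).smulRight (K i (e j)) :=
    fun i => by
      ext x
      have hx := congrArg (K i) (e.sum_repr x)
      rw [map_sum] at hx
      rw [← hx]
      simp
  rw [tendsto_congr h]
  rw [← Finset.sum_const_zero (s := Finset.univ (α := Fin (Module.finrank ℂ E)))]
  refine tendsto_finsetSum _ fun j _ => ?_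
  rw [tendsto_zero_iff_norm_tendsto_zero]
  simp only [ContinuousLinearMap.norm_smulRight_apply]
  simpa using (hK (e j)).norm.const_mul ‖LinearMap.toContinuousLinearMap (e.coord j)‖

/-- Only the square of `D` has to be small. Invertibility comes from `(1 + D) * (1 - D) = 1 - D * D`
with commuting factors, the bound from `z = (1 - D) ((1 + D) z) + (D * D) z`. -/
theorem isUnit_one_add_of_norm_mul_self {Z : Type*} [NormedAddCommGroup Z] [NormedSpace ℂ Z]
    [CompleteSpace Z] {D : Z →L[ℂ] Z} (hD : ‖D * D‖ ≤ 1 / 2) :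
    IsUnit (1 + D) ∧ ∀ z, ‖z‖ ≤ 2 * (1 + ‖D‖) * ‖(1 + D) z‖ := by
  constructor
  · have h := isUnit_one_sub_of_norm_lt_one (x := D * D) (by linarith)
    have e : 1 - D * D = (1 + D) * (1 - D) := by noncomm_ring
    have hc : Commute (1 + D) (1 - D) := by
      change (1 + D) * (1 - D) = (1 - D) * (1 + D)
      noncomm_ring
    rw [e] at h
    exact (hc.isUnit_mul_iff.1 h).1
  · intro z
    have e : z = ((1 + D) z - D ((1 + D) z)) + (D * D) z := by
      simp only [add_apply, one_apply_eq_self, map_add, mul_apply_eq_comp]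
      abel
    have h1 : ‖(D * D) z‖ ≤ 1 / 2 * ‖z‖ := (D * D).le_of_opNorm_le hD z
    have h2 := D.le_opNorm ((1 + D) z)
    have h3 : ‖z‖ ≤ ‖(1 + D) z‖ + ‖D ((1 + D) z)‖ + ‖(D * D) z‖ := by
      conv_lhs => rw [e]
      exact (norm_add_le _ _).trans (add_le_add (norm_sub_le _ _) le_rfl)
    linarith

/-- Let `L i → L₀` in norm and `B i → B₀` strongly, the operators `B i` being of finite rank.
If `(L₀, B₀)` is bijective, then so is eventually `(L i, B i)`, with uniform two-sided bounds. -/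
theorem eventually_bijective_prod {ι X Y F : Type*} [NormedAddCommGroup X] [NormedSpace ℂ X]
    [CompleteSpace X] [NormedAddCommGroup Y] [NormedSpace ℂ Y] [CompleteSpace Y]
    [NormedAddCommGroup F] [NormedSpace ℂ F] [FiniteDimensional ℂ F] {l : Filter ι}
    [l.IsCountablyGenerated] {L : ι → X →L[ℂ] Y} {L₀ : X →L[ℂ] Y} {B : ι → X →L[ℂ] F}
    {B₀ : X →L[ℂ] F} (hL : Tendsto L l (𝓝 L₀)) (hB : ∀ x, Tendsto (fun i => B i x) l (𝓝 (B₀ x)))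
    (h₀ : Function.Bijective (L₀.prod B₀)) :
    ∃ C : ℝ, 0 < C ∧ ∀ᶠ i in l, Function.Bijective ((L i).prod (B i)) ∧
      ∀ x, ‖(L i).prod (B i) x‖ ≤ C * ‖x‖ ∧ ‖x‖ ≤ C * ‖(L i).prod (B i) x‖ := by
  have : CompleteSpace F := FiniteDimensional.complete ℂ F
  set T₀ : X →L[ℂ] Y × F := L₀.prod B₀ with hT₀
  set e := ContinuousLinearEquiv.ofBijective T₀ (LinearMap.ker_eq_bot.2 h₀.1)
    (LinearMap.range_eq_top.2 h₀.2)
  set S : Y × F →L[ℂ] X := (e.symm : Y × F →L[ℂ] X)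
  have hST : ∀ x, S (T₀ x) = x := fun x => e.symm_apply_apply x
  -- `P i` tends to zero in norm, `K i` only strongly; but `K i` restricted to the
  -- finite-dimensional factor `F` tends to zero in norm, and this is enough for the square of `D
  -- i`.
  set P : ι → Y × F →L[ℂ] Y := fun i => (L i - L₀).comp S
  set K : ι → Y × F →L[ℂ] F := fun i => (B i - B₀).comp S
  set il : Y →L[ℂ] Y × F := ContinuousLinearMap.inl ℂ Y F
  set ir : F →L[ℂ] Y × F := ContinuousLinearMap.inr ℂ Y F
  have hil : ∀ y, ‖il y‖ = ‖y‖ := fun y => by simp [il]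
  have hir : ∀ y, ‖ir y‖ = ‖y‖ := fun y => by simp [ir]
  set D : ι → Y × F →L[ℂ] Y × F := fun i => il.comp (P i) + ir.comp (K i)
  have hDT : ∀ i x, (L i).prod (B i) x = (1 + D i) (T₀ x) := fun i x => by
    have hx : S (L₀ x, B₀ x) = x := hST x
    refine Prod.ext ?_ ?_ <;> simp [D, il, ir, P, K, hx, hT₀]
  have hPt : Tendsto (fun i => ‖P i‖) l (𝓝 0) := by
    have : Tendsto (fun i => ‖L i - L₀‖ * ‖S‖) l (𝓝 0) := by
      have := (tendsto_iff_norm_sub_tendsto_zero.1 hL).mul_const ‖S‖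
      rwa [zero_mul] at this
    exact squeeze_zero (fun i => norm_nonneg _) (fun i => (L i - L₀).opNorm_comp_le S) this
  have hKs : ∀ z, Tendsto (fun i => K i z) l (𝓝 0) := fun z => by
    have := (hB (S z)).sub_const (B₀ (S z))
    rwa [sub_self] at this
  have hKt : Tendsto (fun i => ‖(K i).comp ir‖) l (𝓝 0) := by
    rw [← tendsto_zero_iff_norm_tendsto_zero]
    exact tendsto_zero_of_forall_tendsto_zero fun c => hKs (ir c)
  obtain ⟨M₀, hM₀⟩ := eventually_norm_le_of_tendsto (B := K) (B₀ := 0) hKs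
  obtain ⟨M, hM, hM1⟩ : ∃ M : ℝ, (∀ᶠ i in l, ‖K i‖ ≤ M) ∧ 1 ≤ M :=
    ⟨max M₀ 1, hM₀.mono fun i hi => hi.trans (le_max_left _ _), le_max_right _ _⟩
  -- With `P i` and `(K i).comp ir` of norm below `1 / (8 * M)`, the terms `il P D`, `ir K il P` and
  -- `ir K ir K` of the square have norms at most `1/4`, `1/8` and `1/8`.
  have hδ : (0 : ℝ) < 1 / (8 * M) := by positivity
  -- The bracket bounds the inverses, with `1` added for positivity; the last term bounds the
  -- operators.
  refine ⟨(2 * (2 + M) * ‖S‖ + 1) + (2 + M) * ‖T₀‖, by positivity, ?_⟩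
  filter_upwards [hM, hPt.eventually_lt_const hδ, hKt.eventually_lt_const hδ] with i h1 h2 h3
  have hPle : ‖P i‖ ≤ 1 := h2.le.trans (by rw [div_le_one (by positivity)]; linarith)
  have hDn : ‖D i‖ ≤ 1 + M := by
    refine ContinuousLinearMap.opNorm_le_bound _ (by positivity) fun z => ?_
    have e1 : ‖il (P i z)‖ ≤ 1 * ‖z‖ := by rw [hil]; exact (P i).le_of_opNorm_le hPle z
    have e2 : ‖ir (K i z)‖ ≤ M * ‖z‖ := by rw [hir]; exact (K i).le_of_opNorm_le h1 z
    calc ‖D i z‖ ≤ ‖il (P i z)‖ + ‖ir (K i z)‖ := norm_add_le _ _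
      _ ≤ _ := by linarith
  have hDD : ‖D i * D i‖ ≤ 1 / 2 := by
    refine ContinuousLinearMap.opNorm_le_bound _ (by positivity) fun z => ?_
    have hz := norm_nonneg z
    have hδM : 1 / (8 * M) * M = 1 / 8 := by field_simp
    have hPb : ∀ w, ‖P i w‖ ≤ 1 / (8 * M) * ‖w‖ := fun w => (P i).le_of_opNorm_le h2.le w
    have hKb : ∀ w, ‖K i w‖ ≤ M * ‖w‖ := fun w => (K i).le_of_opNorm_le h1 w
    have e1 : ‖il (P i (D i z))‖ ≤ 1 / 4 * ‖z‖ := by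
      rw [hil]
      have hDz : ‖D i z‖ ≤ 2 * M * ‖z‖ :=
        (D i).le_of_opNorm_le (hDn.trans (by linarith)) z
      calc _ ≤ 1 / (8 * M) * ‖D i z‖ := hPb _
        _ ≤ 1 / (8 * M) * (2 * M * ‖z‖) := mul_le_mul_of_nonneg_left hDz hδ.le
        _ = 2 * (1 / (8 * M) * M) * ‖z‖ := by ring
        _ = _ := by rw [hδM]; ring
    have e2 : ‖ir (K i (il (P i z)))‖ ≤ 1 / 8 * ‖z‖ := by
      rw [hir]
      calc _ ≤ M * ‖il (P i z)‖ := hKb _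
        _ ≤ M * (1 / (8 * M) * ‖z‖) := by rw [hil]; gcongr; exact hPb z
        _ = (1 / (8 * M) * M) * ‖z‖ := by ring
        _ = _ := by rw [hδM]
    have e3 : ‖ir (K i (ir (K i z)))‖ ≤ 1 / 8 * ‖z‖ := by
      rw [hir]
      calc _ ≤ 1 / (8 * M) * ‖K i z‖ := ((K i).comp ir).le_of_opNorm_le h3.le _
        _ ≤ 1 / (8 * M) * (M * ‖z‖) := mul_le_mul_of_nonneg_left (hKb z) hδ.le
        _ = (1 / (8 * M) * M) * ‖z‖ := by ring
        _ = _ := by rw [hδM]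
    have e : (D i * D i) z =
        il (P i (D i z)) + (ir (K i (il (P i z))) + ir (K i (ir (K i z)))) := by
      rw [← map_add, ← map_add]
      rfl
    rw [e]
    calc _ ≤ ‖il (P i (D i z))‖ + (‖ir (K i (il (P i z)))‖ + ‖ir (K i (ir (K i z)))‖) :=
          (norm_add_le _ _).trans (add_le_add le_rfl (norm_add_le _ _))
      _ ≤ _ := by linarith
  obtain ⟨hu, hb⟩ := isUnit_one_add_of_norm_mul_self hDD
  refine ⟨?_, fun x => ?_⟩
  · have hcomp : ⇑((L i).prod (B i)) = ⇑(1 + D i) ∘ ⇑T₀ := funext fun x => hDT i x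
    rw [hcomp]
    refine Function.Bijective.comp ?_ h₀
    obtain ⟨v, hv⟩ := hu
    rw [← hv]
    exact (ContinuousLinearEquiv.unitsEquiv ℂ (Y × F) v).bijective
  · have hx := norm_nonneg x
    constructor
    · rw [hDT]
      have h4 : ‖(1 + D i) (T₀ x)‖ ≤ (2 + M) * (‖T₀‖ * ‖x‖) := by
        calc _ ≤ ‖T₀ x‖ + ‖D i (T₀ x)‖ := norm_add_le _ _
          _ ≤ ‖T₀ x‖ + (1 + M) * ‖T₀ x‖ := add_le_add le_rfl ((D i).le_of_opNorm_le hDn _)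
          _ = (2 + M) * ‖T₀ x‖ := by ring
          _ ≤ _ := by gcongr; exact T₀.le_opNorm x
      refine h4.trans ?_
      rw [← mul_assoc]
      gcongr
      have : 0 ≤ 2 * (2 + M) * ‖S‖ + 1 := by positivity
      linarith
    · rw [hDT]
      have hn := norm_nonneg ((1 + D i) (T₀ x))
      have h4 : ‖x‖ ≤ ‖S‖ * ‖T₀ x‖ := by
        conv_lhs => rw [← hST x]
        exact S.le_opNorm _
      have h5 : ‖T₀ x‖ ≤ 2 * (2 + M) * ‖(1 + D i) (T₀ x)‖ := by
        exact (hb _).trans (mul_le_mul_of_nonneg_right (by linarith) hn)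
      calc _ ≤ ‖S‖ * (2 * (2 + M) * ‖(1 + D i) (T₀ x)‖) :=
            h4.trans (mul_le_mul_of_nonneg_left h5 (norm_nonneg _))
        _ = 2 * (2 + M) * ‖S‖ * ‖(1 + D i) (T₀ x)‖ := by ring
        _ ≤ _ := by
            gcongr
            have : 0 ≤ (2 + M) * ‖T₀‖ := by positivity
            linarith

/-! ### Integral equations of Carathéodory type -/

theorem integral_mul_exp_primitive {a t : ℝ} {κ : ℝ → ℝ}
    (hκ : IntervalIntegrable κ volume a t) :
    ∫ s in a..t, κ s * Real.exp (2 * ∫ τ in a..s, κ τ)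
      = (Real.exp (2 * ∫ τ in a..t, κ τ) - 1) / 2 := by
  set α : ℝ → ℝ := fun s => 2 * ∫ τ in a..s, κ τ with hα
  have hαc : AbsolutelyContinuousOnInterval α a t :=
    (hκ.absolutelyContinuousOnInterval_intervalIntegral left_mem_uIcc).const_mul 2
  obtain ⟨C, hC⟩ := hαc.exists_bound
  obtain ⟨K, hK⟩ := Real.contDiff_exp.contDiffOn.exists_lipschitzOnWith (s := Icc (-C) C)
    (n := 1) (by simp) (convex_Icc _ _) isCompact_Icc
  have hmem : ∀ s ∈ uIcc a t, α s ∈ Icc (-C) C := fun s hs => abs_le.1 (hC s hs)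
  -- As `κ` is merely integrable, the integrand is half the derivative of `exp ∘ α` only almost
  -- everywhere, so absolute continuity is needed. It holds because `exp` is Lipschitz on the
  -- bounded range of `α`.
  have hexp : AbsolutelyContinuousOnInterval (fun s => Real.exp (α s)) a t := by
    have h2 := (show Tendsto _ _ _ from hαc).const_mul (K : ℝ)
    rw [mul_zero] at h2
    refine squeeze_zero' (Eventually.of_forall fun E => Finset.sum_nonneg fun i _ => dist_nonneg)
      ?_ h2
    refine Filter.mem_inf_of_right (mem_principal.2 fun E hE => ?_)
    rw [mem_ofPred_eq, Finset.mul_sum]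
    refine Finset.sum_le_sum fun i hi => ?_
    obtain ⟨h3, h4⟩ := hE.1 i hi
    exact hK.dist_le_mul _ (hmem _ h3) _ (hmem _ h4)
  have h1 := hexp.integral_deriv_eq_sub
  have h2 : ∫ s in a..t, deriv (fun s => Real.exp (α s)) s
      = ∫ s in a..t, 2 * (κ s * Real.exp (α s)) := by
    refine intervalIntegral.integral_congr_ae ?_
    filter_upwards [hκ.ae_hasDerivAt_integral] with s hs hst
    have h3 := ((hs (uIoc_subset_uIcc hst) a left_mem_uIcc).const_mul 2).exp
    rw [h3.deriv]
    ring
  rw [h2, intervalIntegral.integral_const_mul] at h1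
  have h0 : α a = 0 := by simp [hα]
  rw [h0, Real.exp_zero] at h1
  linarith

theorem continuous_primitive_Icc {F : Type*} [NormedAddCommGroup F] [NormedSpace ℝ F] {a b : ℝ}
    (hab : a ≤ b) {g : ℝ → F} (hg : IntervalIntegrable g volume a b) :
    Continuous fun t : Icc a b => ∫ s in a..t, g s := by
  have := intervalIntegral.continuousOn_primitive_interval (μ := volume) (f := g)
    (a := a) (b := b) (by
      rw [uIcc_of_le hab]; exact (intervalIntegrable_iff_integrableOn_Icc_of_le hab).1 hg)
  rw [uIcc_of_le hab, continuousOn_iff_continuous_domRestrict] at this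
  exact this

/-- Global solvability of an integral equation of Carathéodory type, with a right-hand side that
satisfies a Lipschitz condition with an integrable constant. -/
theorem exists_eq_add_integral {E : Type*} [NormedAddCommGroup E] [NormedSpace ℝ E]
    [CompleteSpace E] {a b : ℝ} (hab : a ≤ b) {G : ℝ → E → E} {κ : ℝ → ℝ}
    (hκ₀ : ∀ t, 0 ≤ κ t) (hκ : IntervalIntegrable κ volume a b)
    (hG : ∀ t u v, ‖G t u - G t v‖ ≤ κ t * ‖u - v‖)
    (hint : ∀ u : ℝ → E, Continuous u → IntervalIntegrable (fun t => G t (u t)) volume a b)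
    (c : E) :
    ∃ u : ℝ → E, Continuous u ∧ ∀ t ∈ Icc a b, u t = c + ∫ s in a..t, G s (u s) := by
  set α : ℝ → ℝ := fun s => ∫ τ in a..s, κ τ with hα
  have hsub : ∀ t ∈ Icc a b, uIcc a t ⊆ uIcc a b := fun t ht => by
    rw [uIcc_of_le hab, uIcc_of_le ht.1]; exact Icc_subset_Icc_right ht.2
  have hαc : Continuous fun t : Icc a b => α t := continuous_primitive_Icc hab hκ
  -- The substitution `u = exp (2 α) • v`, a weight of Bielecki type, makes the Picard map a
  -- contraction with factor `1/2` on all of `[a,b]`, however large the integral of `κ`.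
  set U : C(Icc a b, E) → ℝ → E := fun v => IccExtend hab fun t => Real.exp (2 * α t) • v t with hU
  have hUc : ∀ v, Continuous (U v) := fun v =>
    ((Real.continuous_exp.comp (continuous_const.mul hαc)).smul v.continuous).Icc_extend'
  have hUe : ∀ (v : C(Icc a b, E)) (t : ℝ) (ht : t ∈ Icc a b),
      U v t = Real.exp (2 * α t) • v ⟨t, ht⟩ := fun v t ht => IccExtend_of_mem hab _ ht
  set Φ : C(Icc a b, E) → C(Icc a b, E) := fun v =>
    ⟨fun t => Real.exp (-(2 * α t)) • (c + ∫ s in a..t, G s (U v s)),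
      (Real.continuous_exp.comp (continuous_const.mul hαc).neg).smul
        (continuous_const.add (continuous_primitive_Icc hab (hint _ (hUc v))))⟩ with hΦ
  have hΦc : ContractingWith (1 / 2) Φ := by
    refine ⟨by norm_num, LipschitzWith.of_dist_le_mul fun v w => ?_⟩
    rw [ContinuousMap.dist_le (by positivity)]
    rintro ⟨t, ht⟩
    have hi : ∀ v, IntervalIntegrable (fun s => G s (U v s)) volume a t := fun v =>
      (hint _ (hUc v)).mono_set (hsub t ht)
    have hκt := hκ.mono_set (hsub t ht)
    have e : Φ v ⟨t, ht⟩ - Φ w ⟨t, ht⟩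
        = Real.exp (-(2 * α t)) • ∫ s in a..t, (G s (U v s) - G s (U w s)) := by
      rw [intervalIntegral.integral_sub (hi v) (hi w)]
      simp only [hΦ, ContinuousMap.coe_mk, ← smul_sub]
      congr 1
      abel
    have hαt : ContinuousOn (fun s => Real.exp (2 * α s)) (uIcc a t) := by
      have : ContinuousOn α (Icc a b) := continuousOn_iff_continuous_domRestrict.2 hαc
      rw [uIcc_of_le ht.1]
      exact (Real.continuous_exp.comp_continuousOn (continuousOn_const.mul this)).mono
        (Icc_subset_Icc_right ht.2)
    have hb : ‖∫ s in a..t, (G s (U v s) - G s (U w s))‖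
        ≤ (Real.exp (2 * α t) - 1) / 2 * dist v w := by
      rw [← integral_mul_exp_primitive hκt, ← intervalIntegral.integral_mul_const]
      refine intervalIntegral.norm_integral_le_of_norm_le ht.1
        (ae_of_all _ fun s hs => ?_)
        ((hκt.mul_continuousOn hαt).mul_const _)
      have hs' : s ∈ Icc a b := ⟨hs.1.le, hs.2.trans ht.2⟩
      refine (hG _ _ _).trans ?_
      rw [hUe v s hs', hUe w s hs', ← smul_sub, norm_smul, Real.norm_of_nonneg (Real.exp_pos _).le,
        ← mul_assoc, ← dist_eq_norm]
      exact mul_le_mul_of_nonneg_left (ContinuousMap.dist_apply_le_dist _)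
        (mul_nonneg (hκ₀ s) (Real.exp_pos _).le)
    rw [dist_eq_norm, e, norm_smul, Real.norm_of_nonneg (Real.exp_pos _).le]
    have hd : (0 : ℝ) ≤ dist v w := dist_nonneg
    calc _ ≤ Real.exp (-(2 * α t)) * ((Real.exp (2 * α t) - 1) / 2 * dist v w) :=
          mul_le_mul_of_nonneg_left hb (Real.exp_pos _).le
      _ ≤ Real.exp (-(2 * α t)) * (Real.exp (2 * α t) / 2 * dist v w) := by
          gcongr; linarith
      _ = (Real.exp (-(2 * α t)) * Real.exp (2 * α t)) / 2 * dist v w := by ring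
      _ = _ := by rw [← Real.exp_add]; simp
  obtain ⟨v, hv, -⟩ := hΦc.exists_fixedPoint 0 (edist_ne_top _ _)
  refine ⟨U v, hUc v, fun t ht => ?_⟩
  have h1 : Φ v ⟨t, ht⟩ = v ⟨t, ht⟩ := by rw [hv]
  rw [hUe v t ht, ← h1]
  simp only [hΦ, ContinuousMap.coe_mk]
  rw [smul_smul, ← Real.exp_add]
  simp

/-! ### The differential expression as a bounded operator -/

theorem MemSobolev.sub {p a b : ℝ} (hab : a < b) {k : ℕ} {x y : ℝ → ℂ}
    (hx : MemSobolev p a b k x) (hy : MemSobolev p a b k y) : MemSobolev p a b k (x - y) := by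
  have := hx.add hab (hy.const_smul (-1))
  rwa [neg_one_smul, ← sub_eq_add_neg] at this

theorem sumN_zero (p a b : ℝ) (k : ℕ) : sumN p a b k 0 = 0 := by
  refine Finset.sum_eq_zero fun j _ => ?_
  have : iteratedDerivWithin j (0 : ℝ → ℂ) (Icc a b) = 0 := by
    have := funext fun t => iteratedDerivWithin_const_smul_field (n := j) (s := Icc a b) (x := t)
      (0 : ℂ) (0 : ℝ → ℂ)
    rw [zero_smul] at this
    rw [this]
    funext t
    simp
  rw [this, lpN, eLpNorm_zero, ENNReal.toReal_zero]

theorem MemSobolev.sum {p a b : ℝ} (hp : 1 ≤ p) (hab : a < b) {k : ℕ} {ι : Type*} (s : Finset ι)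
    {x : ι → ℝ → ℂ} (hx : ∀ i ∈ s, MemSobolev p a b k (x i)) :
    MemSobolev p a b k (∑ i ∈ s, x i) ∧
      sumN p a b k (∑ i ∈ s, x i) ≤ ∑ i ∈ s, sumN p a b k (x i) := by
  classical
  induction s using Finset.induction_on with
  | empty => simpa [sumN_zero] using MemSobolev.zero p a b k
  | insert i s his ih =>
    obtain ⟨h1, h2⟩ := ih fun j hj => hx j (Finset.mem_insert_of_mem hj)
    have h3 := hx i (Finset.mem_insert_self i s)
    rw [Finset.sum_insert his, Finset.sum_insert his]
    exact ⟨h3.add hab h1, (sumN_add_le hp hab h3 h1).trans (add_le_add le_rfl h2)⟩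

/-- The lower order terms `∑_{k < r} A_k y^(k)` of the differential expression. -/
def lowerPart (a b : ℝ) {m r : ℕ} (A : Fin r → ℝ → Matrix (Fin m) (Fin m) ℂ)
    (y : ℝ → Fin m → ℂ) (t : ℝ) : Fin m → ℂ :=
  ∑ k : Fin r, (A k t).mulVec (vecDeriv a b k y t)

theorem lowerPart_apply (a b : ℝ) {m r : ℕ} (A : Fin r → ℝ → Matrix (Fin m) (Fin m) ℂ)
    (y : ℝ → Fin m → ℂ) (i : Fin m) :
    (fun t => lowerPart a b A y t i) = ∑ k : Fin r, ∑ j, (fun t => A k t i j) *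
      iteratedDerivWithin k (fun s => y s j) (Icc a b) := by
  funext t
  simp [lowerPart, Matrix.mulVec, dotProduct, vecDeriv]

theorem diffExpr_eq (a b : ℝ) {m r : ℕ} (A : Fin r → ℝ → Matrix (Fin m) (Fin m) ℂ)
    (y : ℝ → Fin m → ℂ) : diffExpr a b A y = vecDeriv a b r y + lowerPart a b A y := rfl

theorem matNorm_nonneg (p : ℝ) {a b : ℝ} (hab : a < b) (k : ℕ) {m : ℕ}
    (M : ℝ → Matrix (Fin m) (Fin m) ℂ) : 0 ≤ matNorm p a b k M :=
  Finset.sum_nonneg fun _ _ => Finset.sum_nonneg fun _ _ => sobolevNorm_nonneg p hab k _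

theorem MemSobolevMat.sumN_le {p a b : ℝ} (hp : 1 ≤ p) (hab : a < b) {k m : ℕ}
    {M : ℝ → Matrix (Fin m) (Fin m) ℂ} (hM : MemSobolevMat p a b k M) (i j : Fin m) :
    sumN p a b k (fun t => M t i j) ≤ (k + 1) * matNorm p a b k M := by
  refine (sumN_le_sobolevNorm hp hab (hM i j)).trans ?_
  have h1 := Finset.single_le_sum (f := fun j => sobolevNorm p a b k fun t => M t i j)
    (fun j _ => sobolevNorm_nonneg p hab k _) (Finset.mem_univ j)
  have h2 := Finset.single_le_sum (f := fun i => ∑ j, sobolevNorm p a b k fun t => M t i j)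
    (fun i _ => Finset.sum_nonneg fun j _ => sobolevNorm_nonneg p hab k _) (Finset.mem_univ i)
  exact mul_le_mul_of_nonneg_left (h1.trans h2) (by positivity)

section Operators

variable {a b : ℝ} {hab : a < b} {p : ℝ} {n m r : ℕ}

theorem vecDeriv_mem (y : SobolevVec hab p (n + r) m) :
    vecDeriv a b r (y : ℝ → Fin m → ℂ) ∈ SobolevVec hab p n m := fun i =>
  MemSobolev.iteratedDerivWithin hab (y.2 i)

variable [Fact (1 ≤ ENNReal.ofReal p)]

/-- Each `y^(k)` with `k < r` lies in `W^{n+1}_p`, one order above the coefficients, so the product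
estimate applies. A bound proportional to the coefficient norms can then be used for the difference
of two operators. -/
theorem exists_lowerPart_bound (hab : a < b) (p : ℝ) (n m r : ℕ)
    [Fact (1 ≤ ENNReal.ofReal p)] : ∃ K : ℝ, 0 ≤ K ∧
    ∀ A : Fin r → ℝ → Matrix (Fin m) (Fin m) ℂ, (∀ k, MemSobolevMat p a b n (A k)) →
      ∀ y : SobolevVec hab p (n + r) m, lowerPart a b A y ∈ SobolevVec hab p n m ∧
        ∀ i, sumN p a b n (fun t => lowerPart a b A y t i) ≤
          K * (∑ k, matNorm p a b n (A k)) * vecNorm p a b (n + r) (y : ℝ → Fin m → ℂ) := by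
  have hp : 1 ≤ p := one_le_of_fact
  obtain ⟨K, hK, h⟩ := exists_sumN_mul_le hp hab n
  refine ⟨m * (K * ((n + 1) * ((n + r : ℕ) + 1))), by positivity, fun A hA y => ?_⟩
  have hd : ∀ (k : Fin r) (j : Fin m), MemSobolev p a b (n + 1)
      (iteratedDerivWithin k (fun s => (y : ℝ → Fin m → ℂ) s j) (Icc a b)) := fun k j =>
    MemSobolev.iteratedDerivWithin hab ((y.2 j).of_le hab (by have := k.2; omega))
  have hv := vecNorm_nonneg p hab (n + r) (y : ℝ → Fin m → ℂ)
  have hdn : ∀ (k : Fin r) (j : Fin m), sumN p a b (n + 1)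
      (iteratedDerivWithin k (fun s => (y : ℝ → Fin m → ℂ) s j) (Icc a b))
      ≤ ((n + r : ℕ) + 1) * vecNorm p a b (n + r) (y : ℝ → Fin m → ℂ) := fun k j =>
    (sumN_iteratedDerivWithin_le p a b (n + 1) k _).trans
      ((sumN_mono p a b (by have := k.2; omega) _).trans (sumN_le_vecNorm y j))
  have hterm : ∀ (i : Fin m) (k : Fin r) (j : Fin m), sumN p a b n ((fun t => A k t i j) *
      iteratedDerivWithin k (fun s => (y : ℝ → Fin m → ℂ) s j) (Icc a b))
      ≤ K * ((n + 1) * ((n + r : ℕ) + 1)) * matNorm p a b n (A k) *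
        vecNorm p a b (n + r) (y : ℝ → Fin m → ℂ) := fun i k j => by
    refine (h _ _ (hA k i j) (hd k j)).2.trans ?_
    have hMn := matNorm_nonneg p hab n (A k)
    calc _ ≤ K * (((n + 1) * matNorm p a b n (A k)) *
          (((n + r : ℕ) + 1) * vecNorm p a b (n + r) (y : ℝ → Fin m → ℂ))) := by
          refine mul_le_mul_of_nonneg_left (mul_le_mul ((hA k).sumN_le hp hab i j) (hdn k j)
            (sumN_nonneg _ _ _ _ _) (by positivity)) hK
      _ = _ := by ring
  have hin := fun (i : Fin m) (k : Fin r) => MemSobolev.sum hp hab Finset.univ fun j _ =>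
    (h _ _ (hA k i j) (hd k j)).1
  have hout := fun i : Fin m => MemSobolev.sum hp hab Finset.univ fun k _ => (hin i k).1
  refine ⟨fun i => ?_, fun i => ?_⟩
  · rw [lowerPart_apply]
    exact (hout i).1
  · rw [lowerPart_apply]
    refine (hout i).2.trans ?_
    rw [Finset.mul_sum, Finset.sum_mul]
    refine Finset.sum_le_sum fun k _ => (hin i k).2.trans ?_
    refine (Finset.sum_le_card_nsmul _ _ _ fun j _ => hterm i k j).trans_eq ?_
    rw [Finset.card_univ, Fintype.card_fin, nsmul_eq_mul]
    ring

theorem lowerPart_mem {A : Fin r → ℝ → Matrix (Fin m) (Fin m) ℂ}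
    (hA : ∀ k, MemSobolevMat p a b n (A k)) (y : SobolevVec hab p (n + r) m) :
    lowerPart a b A y ∈ SobolevVec hab p n m := by
  obtain ⟨K, -, h⟩ := exists_lowerPart_bound hab p n m r
  exact (h A hA y).1

theorem diffExpr_mem {A : Fin r → ℝ → Matrix (Fin m) (Fin m) ℂ}
    (hA : ∀ k, MemSobolevMat p a b n (A k)) (y : SobolevVec hab p (n + r) m) :
    diffExpr a b A y ∈ SobolevVec hab p n m := by
  rw [diffExpr_eq]
  exact Submodule.add_mem _ (vecDeriv_mem y) (lowerPart_mem hA y)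

/-- The differential expression as a linear map into the data space. -/
def diffLin (A : Fin r → ℝ → Matrix (Fin m) (Fin m) ℂ) (hA : ∀ k, MemSobolevMat p a b n (A k)) :
    SobolevVec hab p (n + r) m →ₗ[ℂ] SobolevData p a b n m where
  toFun y := toData ⟨diffExpr a b A y, diffExpr_mem hA y⟩
  map_add' y z := by
    -- For `n = 0` the derivative of order `r` is additive only off a null set, which `toData` does
    -- not detect.
    rw [← map_add, toData_eq_iff]
    intro i
    have h : ∀ᵐ t ∂(volume.restrict (Icc a b)), ∀ (k : Fin (r + 1)) (j : Fin m),
        iteratedDerivWithin k (fun s => ((y + z : SobolevVec hab p (n + r) m) : ℝ → Fin m → ℂ) s j)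
            (Icc a b) t
          = iteratedDerivWithin k (fun s => (y : ℝ → Fin m → ℂ) s j) (Icc a b) t
            + iteratedDerivWithin k (fun s => (z : ℝ → Fin m → ℂ) s j) (Icc a b) t :=
      eventually_all.2 fun k => eventually_all.2 fun j =>
        MemSobolev.iteratedDerivWithin_add_ae hab (y.2 j) (z.2 j) (by have := k.2; omega)
    filter_upwards [h] with t ht
    have h1 : ∀ k ≤ r, vecDeriv a b k ((y + z : SobolevVec hab p (n + r) m) : ℝ → Fin m → ℂ) t
        = vecDeriv a b k (y : ℝ → Fin m → ℂ) t + vecDeriv a b k (z : ℝ → Fin m → ℂ) t :=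
      fun k hk => funext fun j => ht ⟨k, by omega⟩ j
    change diffExpr a b A _ t i = (diffExpr a b A _ t + diffExpr a b A _ t) i
    refine congrFun ?_ i
    simp only [diffExpr]
    rw [h1 r le_rfl, Finset.sum_congr rfl fun (k : Fin r) _ => by
      rw [h1 k k.2.le, Matrix.mulVec_add], Finset.sum_add_distrib]
    abel
  map_smul' c y := by
    rw [RingHom.id_apply, ← map_smul, toData_eq_iff]
    intro i
    refine Eventually.of_forall fun t => ?_
    have h1 : ∀ k, vecDeriv a b k ((c • y : SobolevVec hab p (n + r) m) : ℝ → Fin m → ℂ) t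
        = c • vecDeriv a b k (y : ℝ → Fin m → ℂ) t :=
      fun k => funext fun j =>
        iteratedDerivWithin_const_smul_field c fun s => (y : ℝ → Fin m → ℂ) s j
    change diffExpr a b A _ t i = (c • diffExpr a b A _ t) i
    refine congrFun ?_ i
    simp only [diffExpr]
    rw [h1 r, Finset.sum_congr rfl fun (k : Fin r) _ => by
      rw [h1 k, Matrix.mulVec_smul], ← Finset.smul_sum, ← smul_add]

theorem diffLin_apply {A : Fin r → ℝ → Matrix (Fin m) (Fin m) ℂ}
    (hA : ∀ k, MemSobolevMat p a b n (A k)) (y : SobolevVec hab p (n + r) m) :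
    diffLin A hA y = toData ⟨diffExpr a b A y, diffExpr_mem hA y⟩ := rfl

theorem diffLin_eq_iff {A : Fin r → ℝ → Matrix (Fin m) (Fin m) ℂ}
    (hA : ∀ k, MemSobolevMat p a b n (A k)) (y : SobolevVec hab p (n + r) m)
    (f : SobolevVec hab p n m) :
    diffLin A hA y = toData f ↔ EqSobolev a b n (diffExpr a b A y) f :=
  toData_eq_iff_eqSobolev

/-- The leading terms `y^(r)` cancel, leaving `lowerPart` with coefficients `A - A'`. Thus
convergence of the coefficients in `W^n_p` becomes norm convergence of the operators. -/
theorem exists_norm_diffLin_sub_le (hab : a < b) (p : ℝ) (n m r : ℕ)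
    [Fact (1 ≤ ENNReal.ofReal p)] : ∃ K : ℝ, 0 ≤ K ∧
    ∀ (A A' : Fin r → ℝ → Matrix (Fin m) (Fin m) ℂ) (hA : ∀ k, MemSobolevMat p a b n (A k))
      (hA' : ∀ k, MemSobolevMat p a b n (A' k)) (y : SobolevVec hab p (n + r) m),
      ‖diffLin A hA y - diffLin A' hA' y‖ ≤
        K * (∑ k, matNorm p a b n (fun t => A k t - A' k t)) *
          vecNorm p a b (n + r) (y : ℝ → Fin m → ℂ) := by
  obtain ⟨K, hK, h⟩ := exists_lowerPart_bound hab p n m r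
  obtain ⟨K', hK', h'⟩ := exists_norm_toData_le_sumN hab p n m
  refine ⟨K' * K, by positivity, fun A A' hA hA' y => ?_⟩
  obtain ⟨h1, h2⟩ := h (fun k t => A k t - A' k t)
    (fun k i j => (hA k i j).sub hab (hA' k i j)) y
  have e : (⟨diffExpr a b A y, diffExpr_mem hA y⟩ : SobolevVec hab p n m)
      - ⟨diffExpr a b A' y, diffExpr_mem hA' y⟩ = ⟨_, h1⟩ := by
    ext t i
    simp [diffExpr, lowerPart, Matrix.sub_mulVec, Finset.sum_sub_distrib]
  have e' : diffLin A hA y - diffLin A' hA' y = toData ⟨_, h1⟩ := by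
    rw [diffLin_apply, diffLin_apply, ← map_sub, e]
  have hnn : 0 ≤ K * (∑ k, matNorm p a b n (fun t => A k t - A' k t)) *
      vecNorm p a b (n + r) (y : ℝ → Fin m → ℂ) :=
    mul_nonneg (mul_nonneg hK (Finset.sum_nonneg fun k _ => matNorm_nonneg p hab n _))
      (vecNorm_nonneg p hab _ _)
  have h3 := h' ⟨_, h1⟩ _ hnn h2
  rw [e', mul_assoc K' K, mul_assoc K']
  exact h3

theorem exists_norm_diffLin_le (A : Fin r → ℝ → Matrix (Fin m) (Fin m) ℂ)
    (hA : ∀ k, MemSobolevMat p a b n (A k)) : ∃ K : ℝ, ∀ y : SobolevVec hab p (n + r) m,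
      ‖diffLin A hA y‖ ≤ K * vecNorm p a b (n + r) (y : ℝ → Fin m → ℂ) := by
  obtain ⟨K, hK, h⟩ := exists_norm_diffLin_sub_le hab p n m r
  obtain ⟨K', hK', h'⟩ := exists_norm_toData_le_sumN hab p n m
  have hz : ∀ k : Fin r, MemSobolevMat p a b n ((0 : Fin r → ℝ → Matrix (Fin m) (Fin m) ℂ) k) :=
    fun k i j => MemSobolev.zero p a b n
  refine ⟨K * (∑ k, matNorm p a b n (fun t => A k t - (0 : Fin r → ℝ → Matrix _ _ ℂ) k t))
    + K' * ((n + r : ℕ) + 1), fun y => ?_⟩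
  have h1 := h A 0 hA hz y
  have hv := vecNorm_nonneg p hab (n + r) (y : ℝ → Fin m → ℂ)
  have h2 : ‖diffLin 0 hz y‖ ≤
      K' * (((n + r : ℕ) + 1) * vecNorm p a b (n + r) (y : ℝ → Fin m → ℂ)) := by
    refine h' _ _ (by positivity) fun i => ?_
    have e : (fun t => diffExpr a b (0 : Fin r → ℝ → Matrix (Fin m) (Fin m) ℂ) y t i)
        = iteratedDerivWithin r (fun s => (y : ℝ → Fin m → ℂ) s i) (Icc a b) := by
      funext t
      simp [diffExpr, vecDeriv]
    show sumN p a b n (fun t => diffExpr a b (0 : Fin r → ℝ → Matrix (Fin m) (Fin m) ℂ) y t i) ≤ _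
    rw [e]
    exact (sumN_iteratedDerivWithin_le p a b n r _).trans (sumN_le_vecNorm y i)
  have h3 := norm_add_le (diffLin A hA y - diffLin 0 hz y) (diffLin 0 hz y)
  rw [sub_add_cancel] at h3
  rw [add_mul]
  linarith

end Operators

/-! ### Chains of primitives and the Cauchy problem -/

section Tower

variable {p a b : ℝ} {r l : ℕ} {Z : ℕ → ℝ → ℂ} {c : ℕ → ℂ}

/-- `Z k` plays the role of the `k`-th derivative of `Z 0`; each integration, descending from `Z r`,
gains one order. -/
theorem memSobolev_of_primitives (hp : 1 ≤ p) (hab : a < b) (hl : MemSobolev p a b l (Z r))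
    (hZ : ∀ k < r, EqOn (Z k) (fun t => c k + ∫ s in a..t, Z (k + 1) s) (Icc a b)) :
    ∀ d ≤ r, MemSobolev p a b (l + d) (Z (r - d)) := by
  intro d
  induction d with
  | zero => exact fun _ => hl
  | succ d ih =>
    intro hd
    have h1 := hZ (r - (d + 1)) (by omega)
    rw [show r - (d + 1) + 1 = r - d by omega] at h1
    exact ((ih (by omega)).primitive hp hab _).congr hab h1.symm

theorem iteratedDerivWithin_of_primitives (hp : 1 ≤ p) (hab : a < b)
    (hl : MemSobolev p a b l (Z r))
    (hZ : ∀ k < r, EqOn (Z k) (fun t => c k + ∫ s in a..t, Z (k + 1) s) (Icc a b)) (j : ℕ) :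
    ∀ k, k + j < r → EqOn (iteratedDerivWithin j (Z k) (Icc a b)) (Z (k + j)) (Icc a b) := by
  induction j with
  | zero => intro k _ t _; simp
  | succ j ih =>
    intro k hk
    rw [iteratedDerivWithin_succ']
    have hm := memSobolev_of_primitives hp hab hl hZ (r - (k + 1)) (by omega)
    rw [show r - (r - (k + 1)) = k + 1 by omega,
      show l + (r - (k + 1)) = l + (r - (k + 1) - 1) + 1 by omega] at hm
    have hd : EqOn (derivWithin (Z k) (Icc a b)) (Z (k + 1)) (Icc a b) := fun t ht => by
      rw [derivWithin_congr (hZ k (by omega)) (hZ k (by omega) ht)]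
      exact (hasDerivWithinAt_primitive hm.continuousOn (c k) ht).derivWithin
        (uniqueDiffOn_Icc hab t ht)
    refine (iteratedDerivWithin_congr hd).trans ?_
    rw [show k + (j + 1) = k + 1 + j by omega]
    exact ih (k + 1) (by omega)

/-- For `l = 0` the function `Z r` is only in `L_p`, so the last differentiation recovers it only
almost everywhere. -/
theorem iteratedDerivWithin_top_of_primitives (hp : 1 ≤ p) (hab : a < b) (hr : 1 ≤ r)
    (hl : MemSobolev p a b l (Z r))
    (hZ : ∀ k < r, EqOn (Z k) (fun t => c k + ∫ s in a..t, Z (k + 1) s) (Icc a b)) :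
    iteratedDerivWithin r (Z 0) (Icc a b) =ᵐ[volume.restrict (Icc a b)] Z r := by
  obtain ⟨q, rfl⟩ : ∃ q, r = q + 1 := ⟨r - 1, by omega⟩
  have h1 : EqOn (iteratedDerivWithin q (Z 0) (Icc a b))
      (fun t => c q + ∫ s in a..t, Z (q + 1) s) (Icc a b) := by
    have := iteratedDerivWithin_of_primitives hp hab hl hZ q 0 (by omega)
    rw [zero_add] at this
    exact this.trans (hZ q (by omega))
  filter_upwards [derivWithin_primitive_ae hab (intervalIntegrable_of_memLp hp hab hl.memLp) (c q),
    ae_restrict_mem measurableSet_Icc] with t ht hti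
  rw [iteratedDerivWithin_succ, derivWithin_congr h1 (h1 hti), ht]

end Tower

theorem intervalIntegrable_fun_sum {F ι : Type*} [NormedAddCommGroup F] {a b : ℝ}
    {s : Finset ι} {g : ι → ℝ → F} (h : ∀ i ∈ s, IntervalIntegrable (g i) volume a b) :
    IntervalIntegrable (fun t => ∑ i ∈ s, g i t) volume a b := by
  have := IntervalIntegrable.sum s h
  rwa [Finset.sum_fn] at this

/-- Solvability of the integral form of the Cauchy problem for `L y = f`. -/
theorem exists_cauchy_integral {p a b : ℝ} (hp : 1 ≤ p) (hab : a < b) {m r : ℕ}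
    {A : Fin r → ℝ → Matrix (Fin m) (Fin m) ℂ} (hA : ∀ k, MemSobolevMat p a b 0 (A k))
    {f : ℝ → Fin m → ℂ} (hf : ∀ i, MemSobolev p a b 0 fun t => f t i) (c : Fin m → ℕ → ℂ) :
    ∃ Z : Fin m → ℕ → ℝ → ℂ, (∀ i, ∀ k < r, ContinuousOn (Z i k) (Icc a b) ∧
        EqOn (Z i k) (fun t => c i k + ∫ s in a..t, Z i (k + 1) s) (Icc a b)) ∧
      ∀ i t, Z i r t = f t i - ∑ k : Fin r, ∑ j, A k t i j * Z j k t := by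
  have hfi : ∀ i, IntervalIntegrable (fun t => f t i) volume a b := fun i =>
    intervalIntegrable_of_memLp hp hab (hf i).memLp
  have hAi : ∀ k i j, IntervalIntegrable (fun t => A k t i j) volume a b := fun k i j =>
    intervalIntegrable_of_memLp hp hab (hA k i j).memLp
  set H : ℝ → (Fin r → Fin m → ℂ) → Fin m → ℂ := fun t u i =>
    f t i - ∑ k : Fin r, ∑ j, A k t i j * u k j with hH
  -- The equivalent first-order system: `u k` stands for `y^(k)`, and the last component obeys the
  -- equation solved for `y^(r)`. In the Lipschitz constant below, the `1` covers the shifted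
  -- components and the sum covers the last one.
  set G : ℝ → (Fin r → Fin m → ℂ) → Fin r → Fin m → ℂ := fun t u k i =>
    if h : (k : ℕ) + 1 < r then u ⟨k + 1, h⟩ i else H t u i with hG
  set κ : ℝ → ℝ := fun t => 1 + ∑ i, ∑ k : Fin r, ∑ j, ‖A k t i j‖ with hκ
  have hκ₀ : ∀ t, 0 ≤ κ t := fun t => by positivity
  have hκi : IntervalIntegrable κ volume a b := by
    refine intervalIntegrable_const.add ?_
    refine intervalIntegrable_fun_sum fun i _ => intervalIntegrable_fun_sum fun k _ =>
      intervalIntegrable_fun_sum fun j _ => (hAi k i j).norm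
  have hL : ∀ t u v, ‖G t u - G t v‖ ≤ κ t * ‖u - v‖ := by
    intro t u v
    have huv : ∀ k j, ‖u k j - v k j‖ ≤ ‖u - v‖ := fun k j =>
      (norm_le_pi_norm ((u - v) k) j).trans (norm_le_pi_norm (u - v) k)
    have h0 : 0 ≤ κ t * ‖u - v‖ := mul_nonneg (hκ₀ t) (norm_nonneg _)
    refine (pi_norm_le_iff_of_nonneg h0).2 fun k => (pi_norm_le_iff_of_nonneg h0).2 fun i => ?_
    simp only [hG, Pi.sub_apply]
    split_ifs with h
    · refine (huv _ _).trans (le_mul_of_one_le_left (norm_nonneg _) ?_)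
      simp only [hκ]
      have : 0 ≤ ∑ i, ∑ k : Fin r, ∑ j, ‖A k t i j‖ := by positivity
      linarith
    · have e : H t u i - H t v i = -∑ k : Fin r, ∑ j, A k t i j * (u k j - v k j) := by
        simp only [hH, mul_sub, Finset.sum_sub_distrib]
        ring
      rw [e, norm_neg]
      calc _ ≤ ∑ k : Fin r, ∑ j, ‖A k t i j‖ * ‖u - v‖ :=
            (norm_sum_le _ _).trans (Finset.sum_le_sum fun k _ => (norm_sum_le _ _).trans
              (Finset.sum_le_sum fun j _ => by
                rw [norm_mul]; exact mul_le_mul_of_nonneg_left (huv k j) (norm_nonneg _)))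
        _ = (∑ k : Fin r, ∑ j, ‖A k t i j‖) * ‖u - v‖ := by simp only [Finset.sum_mul]
        _ ≤ _ := by
            refine mul_le_mul_of_nonneg_right ?_ (norm_nonneg _)
            have := Finset.single_le_sum (f := fun i => ∑ k : Fin r, ∑ j, ‖A k t i j‖)
              (fun i _ => by positivity) (Finset.mem_univ i)
            simp only [hκ]
            linarith
  have hGc : ∀ u : ℝ → Fin r → Fin m → ℂ, Continuous u → ∀ k i,
      IntervalIntegrable (fun t => G t (u t) k i) volume a b := by
    intro u hu k i
    have hcont : ∀ k j, Continuous fun t => u t k j := fun k j =>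
      (continuous_apply j).comp ((continuous_apply k).comp hu)
    simp only [hG]
    split_ifs with h
    · exact (hcont _ _).intervalIntegrable _ _
    · refine (hfi i).sub (intervalIntegrable_fun_sum fun k _ => intervalIntegrable_fun_sum
        fun j _ => (hAi k i j).mul_continuousOn (hcont k j).continuousOn)
  have hGi : ∀ u : ℝ → Fin r → Fin m → ℂ, Continuous u →
      IntervalIntegrable (fun t => G t (u t)) volume a b := by
    intro u hu
    rw [intervalIntegrable_iff]
    exact Integrable.of_eval fun k => Integrable.of_eval fun i =>
      intervalIntegrable_iff.1 (hGc u hu k i)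
  obtain ⟨u, hu, hue⟩ := exists_eq_add_integral hab.le hκ₀ hκi hL hGi
    (fun (k : Fin r) (i : Fin m) => c i k)
  have hcomp : ∀ t ∈ Icc a b, ∀ k i, u t k i = c i k + ∫ s in a..t, G s (u s) k i := by
    intro t ht k i
    have h1 := congrFun (congrFun (hue t ht) k) i
    have hi : IntervalIntegrable (fun s => G s (u s)) volume a t :=
      (hGi u hu).mono_set (by
        rw [uIcc_of_le hab.le, uIcc_of_le ht.1]; exact Icc_subset_Icc_right ht.2)
    have h2 := ((ContinuousLinearMap.proj (R := ℝ) (φ := fun _ : Fin m => ℂ) i).comp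
      (ContinuousLinearMap.proj (R := ℝ) (φ := fun _ : Fin r => Fin m → ℂ) k)
      ).intervalIntegral_comp_comm hi
    rw [h1]
    exact congrArg (c i k + ·) h2.symm
  -- Index `r` carries `y^(r)` as given by the equation; larger indices repeat this value and play
  -- no role.
  refine ⟨fun i k t => if h : k < r then u t ⟨k, h⟩ i else H t (u t) i, fun i k hk => ⟨?_, ?_⟩,
    fun i t => ?_⟩
  · simp only [dif_pos hk]
    exact ((continuous_apply i).comp ((continuous_apply _).comp hu)).continuousOn
  · intro t ht
    simp only [dif_pos hk]
    exact hcomp t ht ⟨k, hk⟩ i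
  · simp [hH]

/-- The Cauchy problem for `L y = f` with initial point `a` has a solution in `(W^{n+r}_p)^m`. -/
theorem exists_cauchy {p a b : ℝ} (hp : 1 ≤ p) (hab : a < b) {n m r : ℕ} (hr : 1 ≤ r)
    {A : Fin r → ℝ → Matrix (Fin m) (Fin m) ℂ} (hA : ∀ k, MemSobolevMat p a b n (A k))
    {f : ℝ → Fin m → ℂ} (hf : f ∈ SobolevVec hab p n m) (c : Fin m → ℕ → ℂ) :
    ∃ y ∈ SobolevVec hab p (n + r) m,
      (∀ i, (fun t => diffExpr a b A y t i) =ᵐ[volume.restrict (Icc a b)] fun t => f t i) ∧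
      ∀ i, ∀ j < r, iteratedDerivWithin j (fun t => y t i) (Icc a b) a = c i j := by
  obtain ⟨Z, hZ, hZr⟩ := exists_cauchy_integral hp hab
    (fun k i j => (hA k i j).of_le hab (Nat.zero_le n))
    (fun i => (hf i).of_le hab (Nat.zero_le n)) c
  have hZe := fun i k hk => (hZ i k hk).2
  have hZr' : ∀ i, Z i r = (fun t => f t i) -
      ∑ k : Fin r, ∑ j, (fun t => A k t i j) * Z j k := fun i => by
    funext t
    simp [hZr]
  -- Bootstrap: if `y^(r)` is in `W^l_p`, all lower derivatives are in `W^{l+1}_p`, and the equation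
  -- puts `y^(r)` into `W^{l+1}_p` as long as `l + 1 ≤ n`. At the start, coefficients in `L_p`
  -- multiply continuous functions.
  have hmem : ∀ l ≤ n, ∀ i, MemSobolev p a b l (Z i r) := by
    intro l
    induction l with
    | zero =>
      intro _ i
      rw [hZr']
      refine ((hf i).of_le hab (Nat.zero_le n)).sub hab (MemSobolev.sum hp hab _ fun k _ =>
        (MemSobolev.sum hp hab _ fun j _ => ?_).1).1
      exact memLp_mul_continuousOn (hA k i j).memLp (hZ j k k.2).1
    | succ l ih =>
      intro hl i
      have h1 : ∀ j, ∀ k < r, MemSobolev p a b (l + 1) (Z j k) := fun j k hk => by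
        have := memSobolev_of_primitives hp hab (ih (by omega) j) (hZe j) (r - k) (by omega)
        rw [show r - (r - k) = k by omega] at this
        exact this.of_le hab (by omega)
      rw [hZr']
      exact ((hf i).of_le hab hl).sub hab (MemSobolev.sum hp hab _ fun k _ =>
        (MemSobolev.sum hp hab _ fun j _ =>
          ((hA k i j).of_le hab hl).mul hp hab (h1 j k k.2) (by omega)).1).1
  have hder := fun i => iteratedDerivWithin_of_primitives hp hab (hmem n le_rfl i) (hZe i)
  refine ⟨fun t i => Z i 0 t, fun i => ?_, fun i => ?_, fun i j hj => ?_⟩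
  · have := memSobolev_of_primitives hp hab (hmem n le_rfl i) (hZe i) r le_rfl
    rwa [Nat.sub_self] at this
  · filter_upwards [iteratedDerivWithin_top_of_primitives hp hab hr (hmem n le_rfl i) (hZe i),
      ae_restrict_mem measurableSet_Icc] with t ht hti
    have h2 : ∀ (k : Fin r) (j : Fin m), iteratedDerivWithin k (Z j 0) (Icc a b) t = Z j k t :=
      fun k j => by simpa using hder j k 0 (by simp) hti
    simp only [diffExpr, vecDeriv, Matrix.mulVec, dotProduct, Pi.add_apply, Finset.sum_apply, h2]
    rw [ht, hZr]
    ring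
  · have h1 := hder i j 0 (by omega) (left_mem_Icc.2 hab.le)
    rw [zero_add] at h1
    refine h1.trans ((hZe i j hj (left_mem_Icc.2 hab.le)).trans ?_)
    simp

/-! ### Invertibility of the boundary-value problem and discrepancy bounds -/

/-- If `(L, Γ)` is surjective and `(L, B)` injective, where `Γ` and `B` take values in spaces of
the same finite dimension, then `(L, B)` is bijective. -/
theorem bijective_prod_of_surjective {X Y F C : Type*} [AddCommGroup X] [Module ℂ X]
    [AddCommGroup Y] [Module ℂ Y] [AddCommGroup F] [Module ℂ F] [FiniteDimensional ℂ F]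
    [AddCommGroup C] [Module ℂ C] [FiniteDimensional ℂ C]
    (hFC : Module.finrank ℂ F = Module.finrank ℂ C) (L : X →ₗ[ℂ] Y) (B : X →ₗ[ℂ] F)
    (Γ : X →ₗ[ℂ] C) (hs : ∀ y c, ∃ x, L x = y ∧ Γ x = c)
    (hi : ∀ x, L x = 0 → B x = 0 → x = 0) : Function.Bijective (L.prod B) := by
  have hBi : Function.Injective (B.domRestrict L.ker) := by
    rw [injective_iff_map_eq_zero]
    exact fun x hx => Subtype.ext (hi x x.2 hx)
  have hΓ : Function.Surjective (Γ.domRestrict L.ker) := fun c => by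
    obtain ⟨x, hx, hxc⟩ := hs 0 c
    exact ⟨⟨x, hx⟩, hxc⟩
  -- Injectivity of `B` and surjectivity of `Γ` on the kernel of `L` force its dimension to equal
  -- that of `F`, so `B` maps it onto `F`; a kernel element then corrects the boundary values of any
  -- solution of `L x = y`.
  have : FiniteDimensional ℂ L.ker := FiniteDimensional.of_injective _ hBi
  have h1 := LinearMap.finrank_le_finrank_of_injective hBi
  have h2 := LinearMap.finrank_le_finrank_of_surjective hΓ
  have hBs : Function.Surjective (B.domRestrict L.ker) :=
    (LinearMap.injective_iff_surjective_of_finrank_eq_finrank (by omega)).1 hBi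
  constructor
  · rw [injective_iff_map_eq_zero]
    intro x hx
    exact hi x (congrArg Prod.fst hx) (congrArg Prod.snd hx)
  · rintro ⟨y, z⟩
    obtain ⟨x, hx, -⟩ := hs y 0
    obtain ⟨v, hv⟩ := hBs (z - B x)
    refine ⟨x + v, Prod.ext ?_ ?_⟩
    · have : L v = 0 := v.2
      simp [hx, this]
    · have : B v = z - B x := hv
      simp [this]

section Problem

variable {a b : ℝ} {hab : a < b} {p : ℝ} {n m r : ℕ} [Fact (1 ≤ ENNReal.ofReal p)]

/-- The initial values of the derivatives of orders less than `r`. -/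
def cauchyData (p a b : ℝ) (n m r : ℕ) :
    SobolevData p a b (n + r) m →ₗ[ℂ] Fin m → Fin r → ℂ where
  toFun d i j := (d i).1 (Fin.castLE (Nat.le_add_left r n) j)
  map_add' _ _ := rfl
  map_smul' _ _ := rfl

theorem isSolution_iff {A : Fin r → ℝ → Matrix (Fin m) (Fin m) ℂ}
    (hA : ∀ k, MemSobolevMat p a b n (A k))
    {B : SobolevVec hab p (n + r) m →ₗ[ℂ] EuclideanSpace ℂ (Fin (r * m))}
    {L : SobolevData p a b (n + r) m →L[ℂ] SobolevData p a b n m}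
    (hL : ∀ y : SobolevVec hab p (n + r) m, L (toData y) = diffLin A hA y)
    {S : SobolevData p a b (n + r) m →L[ℂ] EuclideanSpace ℂ (Fin (r * m))}
    (hS : ∀ y, S (toData y) = B y) (f : SobolevVec hab p n m)
    (c : EuclideanSpace ℂ (Fin (r * m))) (y : SobolevVec hab p (n + r) m) :
    IsSolution A B f c y ↔ L.prod S (toData y) = (toData f, c) := by
  rw [IsSolution, ContinuousLinearMap.prod_apply, Prod.mk.injEq, hL, hS, diffLin_eq_iff]

/-- The boundary-value problem defines an isomorphism as soon as the homogeneous problem has only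
the trivial solution. -/
theorem bijective_of_trivial_kernel (hr : 1 ≤ r) {A : Fin r → ℝ → Matrix (Fin m) (Fin m) ℂ}
    (hA : ∀ k, MemSobolevMat p a b n (A k))
    {B : SobolevVec hab p (n + r) m →ₗ[ℂ] EuclideanSpace ℂ (Fin (r * m))}
    {L : SobolevData p a b (n + r) m →L[ℂ] SobolevData p a b n m}
    (hL : ∀ y : SobolevVec hab p (n + r) m, L (toData y) = diffLin A hA y)
    {S : SobolevData p a b (n + r) m →L[ℂ] EuclideanSpace ℂ (Fin (r * m))}
    (hS : ∀ y, S (toData y) = B y)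
    (h0 : ∀ y : SobolevVec hab p (n + r) m, IsSolution A B 0 0 y →
      ∀ t ∈ Icc a b, (y : ℝ → Fin m → ℂ) t = 0) :
    Function.Bijective (L.prod S) := by
  refine bijective_prod_of_surjective ?_ L.toLinearMap S.toLinearMap
    (cauchyData p a b n m r) (fun g c => ?_) (fun x hLx hSx => ?_)
  · rw [finrank_euclideanSpace_fin, Module.finrank_pi_fintype]
    simp [mul_comm]
  · obtain ⟨f, rfl⟩ := toData_surjective (hab := hab) g
    obtain ⟨y, hy, hyf, hyc⟩ := exists_cauchy one_le_of_fact hab hr hA f.2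
      (fun i j => if h : j < r then c i ⟨j, h⟩ else 0)
    refine ⟨toData ⟨y, hy⟩, ?_, funext fun i => funext fun j => ?_⟩
    · refine (hL _).trans ?_
      rw [diffLin_apply, toData_eq_iff]
      exact hyf
    · refine (hyc i j j.2).trans ?_
      rw [dif_pos j.2]
  · obtain ⟨y, rfl⟩ := toData_surjective (hab := hab) x
    have hsol : IsSolution A B ((0 : SobolevVec hab p n m) : ℝ → Fin m → ℂ) 0 y := by
      rw [isSolution_iff hA hL hS, map_zero]
      exact Prod.ext hLx hSx
    rw [← map_zero (toData (hab := hab) (p := p)), toData_eq_iff_eqOn (by omega)]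
    exact h0 y hsol

/-- The discrepancy is equivalent to the distance of the solutions. -/
theorem exists_discrepancy_bounds (hab : a < b) (p : ℝ) (n m r : ℕ)
    [Fact (1 ≤ ENNReal.ofReal p)] {C : ℝ} (hC : 0 < C) :
    ∃ γ₁ γ₂ : ℝ, 0 < γ₁ ∧ 0 < γ₂ ∧
      ∀ (A : Fin r → ℝ → Matrix (Fin m) (Fin m) ℂ) (hA : ∀ k, MemSobolevMat p a b n (A k))
        (B : SobolevVec hab p (n + r) m →ₗ[ℂ] EuclideanSpace ℂ (Fin (r * m)))
        (L : SobolevData p a b (n + r) m →L[ℂ] SobolevData p a b n m)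
        (S : SobolevData p a b (n + r) m →L[ℂ] EuclideanSpace ℂ (Fin (r * m))),
        (∀ y : SobolevVec hab p (n + r) m, L (toData y) = diffLin A hA y) →
        (∀ y, S (toData y) = B y) →
        (∀ x, ‖L.prod S x‖ ≤ C * ‖x‖ ∧ ‖x‖ ≤ C * ‖L.prod S x‖) →
        ∀ (f : SobolevVec hab p n m) (c : EuclideanSpace ℂ (Fin (r * m)))
          (y z : SobolevVec hab p (n + r) m), IsSolution A B f c z →
          γ₁ * discrepancy A B f c y ≤
              vecNorm p a b (n + r) (fun t => (y : ℝ → Fin m → ℂ) t - (z : ℝ → Fin m → ℂ) t) ∧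
            vecNorm p a b (n + r) (fun t => (y : ℝ → Fin m → ℂ) t - (z : ℝ → Fin m → ℂ) t) ≤
              γ₂ * discrepancy A B f c y := by
  obtain ⟨K₁, hK₁, h₁⟩ := exists_norm_toData_le hab p n m
  obtain ⟨K₂, hK₂, h₂⟩ := exists_vecNorm_le hab p n m
  obtain ⟨K₃, hK₃, h₃⟩ := exists_norm_toData_le hab p (n + r) m
  obtain ⟨K₄, hK₄, h₄⟩ := exists_vecNorm_le hab p (n + r) m
  -- `K₁, …, K₄` convert between Sobolev norms and norms of `toData`, `C` passes through the
  -- operator, and each `+ 1` accounts for the boundary component.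
  refine ⟨1 / ((K₂ + 1) * (C * K₃)), K₄ * (C * (K₁ + 1)), by positivity, by positivity, ?_⟩
  intro A hA B L S hL hS hb f c y z hz
  rw [isSolution_iff hA hL hS] at hz
  set g : SobolevVec hab p n m := ⟨diffExpr a b A y, diffExpr_mem hA y⟩ - f with hg
  -- Because `z` is a solution, the operator maps `y - z` to the residual of `y`.
  have hT : L.prod S (toData (y - z)) = (toData g, B y - c) := by
    rw [map_sub, map_sub, hz, hg, map_sub, ContinuousLinearMap.prod_apply, hL, hS, diffLin_apply]
    rfl
  have hd : discrepancy A B f c y = vecNorm p a b n (g : ℝ → Fin m → ℂ) + ‖B y - c‖ := rfl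
  have hv : (fun t => (y : ℝ → Fin m → ℂ) t - (z : ℝ → Fin m → ℂ) t)
      = ((y - z : SobolevVec hab p (n + r) m) : ℝ → Fin m → ℂ) := rfl
  obtain ⟨hb₁, hb₂⟩ := hb (toData (y - z))
  rw [hT, Prod.norm_def] at hb₁ hb₂
  simp only at hb₁ hb₂
  have hg0 := vecNorm_nonneg p hab n (g : ℝ → Fin m → ℂ)
  have hB0 := norm_nonneg (B y - c)
  rw [hv, hd]
  constructor
  · rw [one_div, inv_mul_le_iff₀ (by positivity)]
    have e1 : vecNorm p a b n (g : ℝ → Fin m → ℂ) + ‖B y - c‖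
        ≤ (K₂ + 1) * max ‖toData g‖ ‖B y - c‖ := by
      have := mul_le_mul_of_nonneg_left (le_max_left ‖toData g‖ ‖B y - c‖) hK₂.le
      linarith [h₂ g, le_max_right ‖toData g‖ ‖B y - c‖]
    refine e1.trans ?_
    rw [mul_assoc]
    refine mul_le_mul_of_nonneg_left (hb₁.trans ?_) (by positivity)
    rw [mul_assoc]
    exact mul_le_mul_of_nonneg_left (h₃ _) hC.le
  · have e1 : max ‖toData g‖ ‖B y - c‖
        ≤ (K₁ + 1) * (vecNorm p a b n (g : ℝ → Fin m → ℂ) + ‖B y - c‖) := by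
      have := mul_nonneg hK₁.le hB0
      refine max_le ((h₁ g).trans ?_) ?_ <;> nlinarith [mul_nonneg hK₁.le hg0]
    refine (h₄ _).trans ?_
    rw [mul_assoc, mul_assoc]
    refine mul_le_mul_of_nonneg_left (hb₂.trans ?_) hK₄.le
    exact mul_le_mul_of_nonneg_left e1 hC.le

end Problem

end BVP

end

/-! ### Assembly of the theorem -/

theorem theorem2 (n m r : ℕ) (hm : 1 ≤ m) (hr : 1 ≤ r) (p : ℝ) (hp : 1 ≤ p)
    (a b : ℝ) (hab : a < b) (ε₀ : ℝ) (hε₀ : 0 < ε₀)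
    (A : ℝ → Fin r → ℝ → Matrix (Fin m) (Fin m) ℂ)
    (hA : ∀ ε ∈ Set.Ico 0 ε₀, ∀ k, BVP.MemSobolevMat p a b n (A ε k))
    (B : ℝ → BVP.SobolevVec hab p (n + r) m →ₗ[ℂ] EuclideanSpace ℂ (Fin (r * m)))
    (hB : ∀ ε ∈ Set.Ico 0 ε₀, BVP.IsBoundedOp (B ε))
    (h0 : BVP.ConditionZero A B)
    (hI : BVP.LimitConditionI p a b n A)
    (hII : BVP.LimitConditionII B) :
    ∃ ε₁ : ℝ, 0 < ε₁ ∧ ε₁ < ε₀ ∧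
      -- for every `ε ∈ [0, ε₁)` the problem is uniquely solvable for all right-hand sides
      (∀ ε ∈ Set.Ico 0 ε₁, ∀ (f : BVP.SobolevVec hab p n m) (c : EuclideanSpace ℂ (Fin (r * m))),
        ∃ y : BVP.SobolevVec hab p (n + r) m, BVP.IsSolution (A ε) (B ε) f c y ∧
          ∀ y' : BVP.SobolevVec hab p (n + r) m, BVP.IsSolution (A ε) (B ε) f c y' →
            Set.EqOn (y' : ℝ → Fin m → ℂ) y (Set.Icc a b)) ∧
      ∃ ε₂ γ₁ γ₂ : ℝ, 0 < ε₂ ∧ ε₂ < ε₁ ∧ 0 < γ₁ ∧ 0 < γ₂ ∧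
        -- the constants serve all right-hand sides and all solutions
        ∀ (f : ℝ → BVP.SobolevVec hab p n m) (c : ℝ → EuclideanSpace ℂ (Fin (r * m)))
          (y : ℝ → BVP.SobolevVec hab p (n + r) m),
          ∀ ε ∈ Set.Ioo 0 ε₂,
            BVP.IsSolution (A 0) (B 0) (f 0) (c 0) (y 0) →
            BVP.IsSolution (A ε) (B ε) (f ε) (c ε) (y ε) →
            γ₁ * BVP.discrepancy (A ε) (B ε) (f ε) (c ε) (y 0)
                ≤ BVP.vecNorm p a b (n + r)
                    (fun t => (y 0 : ℝ → Fin m → ℂ) t - (y ε : ℝ → Fin m → ℂ) t) ∧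
              BVP.vecNorm p a b (n + r)
                    (fun t => (y 0 : ℝ → Fin m → ℂ) t - (y ε : ℝ → Fin m → ℂ) t)
                ≤ γ₂ * BVP.discrepancy (A ε) (B ε) (f ε) (c ε) (y 0) := by
  have hfact : Fact (1 ≤ ENNReal.ofReal p) := ⟨ENNReal.one_le_ofReal.2 hp⟩
  have h0mem : (0 : ℝ) ∈ Ico 0 ε₀ := left_mem_Ico.2 hε₀
  -- Outside `[0, ε₀)` the model operators are set to zero, which does not affect limits at `0+`.
  have hLex : ∀ ε, ∃ L : BVP.SobolevData p a b (n + r) m →L[ℂ] BVP.SobolevData p a b n m,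
      ∀ hε : ε ∈ Ico 0 ε₀, ∀ y : BVP.SobolevVec hab p (n + r) m,
        L (BVP.toData y) = BVP.diffLin (A ε) (hA ε hε) y := fun ε => by
    by_cases hε : ε ∈ Ico 0 ε₀
    · obtain ⟨K, hK⟩ := BVP.exists_norm_diffLin_le (hab := hab) (A ε) (hA ε hε)
      obtain ⟨L, hL⟩ := BVP.exists_continuousLinearMap _ hK
      exact ⟨L, fun _ => hL⟩
    · exact ⟨0, fun h => absurd h hε⟩
  choose L hL using hLex
  have hSex : ∀ ε, ∃ S : BVP.SobolevData p a b (n + r) m →L[ℂ] EuclideanSpace ℂ (Fin (r * m)),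
      ε ∈ Ico 0 ε₀ → ∀ y : BVP.SobolevVec hab p (n + r) m, S (BVP.toData y) = B ε y := fun ε => by
    by_cases hε : ε ∈ Ico 0 ε₀
    · obtain ⟨K, hK⟩ := hB ε hε
      obtain ⟨S, hS⟩ := BVP.exists_continuousLinearMap _ hK
      exact ⟨S, fun _ => hS⟩
    · exact ⟨0, fun h => absurd h hε⟩
  choose S hS using hSex
  have hev : ∀ᶠ ε in 𝓝[>] (0 : ℝ), ε ∈ Ico 0 ε₀ := by
    filter_upwards [Ioo_mem_nhdsGT hε₀] with ε hε using ⟨hε.1.le, hε.2⟩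
  have hLt : Tendsto L (𝓝[>] 0) (𝓝 (L 0)) := by
    obtain ⟨K, hK, h1⟩ := BVP.exists_norm_diffLin_sub_le hab p n m r
    obtain ⟨K', hK', h2⟩ := BVP.exists_vecNorm_le hab p (n + r) m
    rw [tendsto_iff_norm_sub_tendsto_zero]
    have hsum : Tendsto (fun ε => K * (∑ k, BVP.matNorm p a b n fun t => A ε k t - A 0 k t) * K')
        (𝓝[>] 0) (𝓝 0) := by
      have := ((tendsto_finsetSum Finset.univ fun k _ => hI k).const_mul K).mul_const K'
      simpa using this
    refine squeeze_zero' (Eventually.of_forall fun _ => norm_nonneg _) ?_ hsum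
    filter_upwards [hev] with ε hε
    have hnn : 0 ≤ K * ∑ k, BVP.matNorm p a b n fun t => A ε k t - A 0 k t :=
      mul_nonneg hK (Finset.sum_nonneg fun k _ => BVP.matNorm_nonneg p hab n _)
    refine ContinuousLinearMap.opNorm_le_bound _ (mul_nonneg hnn hK'.le) fun d => ?_
    obtain ⟨y, rfl⟩ := BVP.toData_surjective (hab := hab) d
    rw [sub_apply, hL ε hε, hL 0 h0mem, mul_assoc]
    exact (h1 _ _ _ _ y).trans (mul_le_mul_of_nonneg_left (h2 y) hnn)
  have hSt : ∀ d, Tendsto (fun ε => S ε d) (𝓝[>] 0) (𝓝 (S 0 d)) := fun d => by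
    obtain ⟨y, rfl⟩ := BVP.toData_surjective (hab := hab) d
    rw [hS 0 h0mem]
    refine (hII y).congr' ?_
    filter_upwards [hev] with ε hε using (hS ε hε y).symm
  have hbij := BVP.bijective_of_trivial_kernel hr (hA 0 h0mem) (hL 0 h0mem) (hS 0 h0mem) h0
  obtain ⟨C, hC, hall⟩ := BVP.eventually_bijective_prod hLt hSt hbij
  obtain ⟨δ, hδ, hsub⟩ := mem_nhdsGT_iff_exists_Ioo_subset.1 hall
  have hδ : 0 < δ := hδ
  -- Halving makes `ε₁` strictly smaller than both `δ` and `ε₀`.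
  have hε₁ : 0 < min δ ε₀ / 2 := by positivity
  have hε₁δ : min δ ε₀ / 2 < δ := by linarith [min_le_left δ ε₀, lt_min hδ hε₀]
  have hε₁ε₀ : min δ ε₀ / 2 < ε₀ := by linarith [min_le_right δ ε₀, lt_min hδ hε₀]
  refine ⟨min δ ε₀ / 2, hε₁, hε₁ε₀, fun ε hε f c => ?_, ?_⟩
  · have hε' : ε ∈ Ico 0 ε₀ := ⟨hε.1, hε.2.trans hε₁ε₀⟩
    have hb : Function.Bijective ((L ε).prod (S ε)) := by
      -- The filter `𝓝[>] 0` says nothing about `ε = 0`, where bijectivity is `hbij`.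
      rcases hε.1.eq_or_lt with rfl | hpos
      · exact hbij
      · exact (hsub ⟨hpos, hε.2.trans hε₁δ⟩).1
    have hsol := BVP.isSolution_iff (hA ε hε') (hL ε hε') (hS ε hε') f c
    obtain ⟨d, hd⟩ := hb.2 (BVP.toData f, c)
    obtain ⟨y, rfl⟩ := BVP.toData_surjective (hab := hab) d
    refine ⟨y, (hsol y).2 hd, fun y' hy' => ?_⟩
    rw [← BVP.toData_eq_iff_eqOn (by omega)]
    exact hb.1 (((hsol y').1 hy').trans hd.symm)
  · obtain ⟨γ₁, γ₂, hγ₁, hγ₂, h⟩ := BVP.exists_discrepancy_bounds hab p n m r hC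
    refine ⟨min δ ε₀ / 2 / 2, γ₁, γ₂, by positivity, by linarith, hγ₁, hγ₂, ?_⟩
    intro f c y ε hε _ hyε
    have hlt : ε < min δ ε₀ / 2 := by linarith [hε.2]
    have hε' : ε ∈ Ico 0 ε₀ := ⟨hε.1.le, hlt.trans hε₁ε₀⟩
    exact h _ (hA ε hε') _ _ _ (hL ε hε') (hS ε hε') (hsub ⟨hε.1, hlt.trans hε₁δ⟩).2 _ _ _ _ hyε
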